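/- Let $d\ge 1$ and $s\ge 1$ be integers, let $\beta>-d-s$ be real, and let $\lambda_0,\dots,\lambda_{s-1}>0$. Let $\mathbb V_0^{d+1}=\{(x,t)\in\mathbb R^{d}\times\mathbb R:\ \|x\|=t,\ 0\le t\le 1\}$, with the measure $d\mathsf m$ given by $\int f\,d\mathsf m=\int_0^1 t^{d-1}\int_{\mathbb S^{d-1}}f(t\xi,t)\,d\sigma(\xi)\,dt$, where $\sigma$ is the surface measure and $\omega_d$ the surface area of $\mathbb S^{d-1}$. Polynomials on the cone are the elements of $\mathbb R[x,t]/\langle t^2-\|x\|^2\rangle$. Each class contains exactly one polynomial $F(x,t)$ that is harmonic in $x$, and $\partial_t$ of the class means the class of the partial derivative $\partial F/\partial t$ of this representative; equivalently, $\partial_t$ is the linear operator with $\partial_t\big(p(t)Y(x)\big)=p'(t)Y(x)$ for every polynomial $p$ and every solid harmonic $Y$. For polynomials $f,g$ on the cone let $$\langle f,g\rangle_{\beta,-s}=\frac1{\omega_d}\int_{\mathbb V_0^{d+1}}\partial_t^sf(x,t)\,\partial_t^sg(x,t)\,t^{\beta+s}\,d\mathsf m(x,t)+\sum_{k=0}^{s-1}\frac{\lambda_k}{\omega_d}\int_{\mathbb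 S^{d-1}}\partial_t^kf(\xi,1)\,\partial_t^kg(\xi,1)\,d\sigma(\xi).$$ Let $\mathcal V_n^d(\mathsf w_{\beta,-s})$ be the space of polynomials on the cone of degree at most $n$ that are orthogonal, for $\langle\cdot,\cdot\rangle_{\beta,-s}$, to all polynomials of degree less than $n$. For each $m\ge0$ let $\{Y_\ell^m:1\le\ell\le\dim\mathcal H_m^d\}$ be a basis of the space $\mathcal H^{d}_m$ of homogeneous harmonic polynomials of degree $m$ in $d$ variables, orthonormal for $\frac1{\omega_d}\int_{\mathbb S^{d-1}}fg\,d\sigma$. For real $a$ and integers $n\ge 0$ let $(a)_n=a(a+1)\cdots(a+n-1)$. For $\alpha,\gamma>-1$ let $$P_n^{(\alpha,\gamma)}(t)=\frac{(\alpha+1)_n}{n!}\sum_{k=0}^n\frac{(-n)_k(n+\alpha+\gamma+1)_k}{(\alpha+1)_k\,k!}\Big(\frac{1-t}2\Big)^k$$ be the Jacobi polynomials, $A_n^{(\alpha,\gamma)}=2^n/(n+\alpha+\gamma+1)_n$ and $\widehat P_n^{(\alpha,\gamma)}=A_n^{(\alpha,\gamma)}P_n^{(\alpha,\gamma)}$.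 For $\alpha+s>-1$ let $$J_n^{(\alpha,-s)}(t)=\begin{cases}\dfrac{(t+1)^n}{n!},&0\le n\le s-1,\\[2mm]\displaystyle\int_{-1}^t\frac{(t-u)^{s-1}}{(s-1)!}\,\widehat P_{n-s}^{(\alpha+s,0)}(u)\,du,&n\ge s.\end{cases}$$ For $0\le m\le n$ and $1\le\ell\le\dim\mathcal H_m^d$ put $$\mathsf S_{m,\ell}^{n,(\beta,-s)}(x,t)=J_{n-m}^{(2m+\beta+d-1,-s)}(1-2t)\,Y_\ell^m(x).$$ Then, for every $n\ge0$, the polynomials $\mathsf S_{m,\ell}^{n,(\beta,-s)}$, $0\le m\le n$, $1\le\ell\le\dim\mathcal H_m^d$, form a basis of $\mathcal V_n^d(\mathsf w_{\beta,-s})$. All the polynomials $\mathsf S_{m,\ell}^{n,(\beta,-s)}$ with distinct $(n,m,\ell)$ are mutually orthogonal for $\langle\cdot,\cdot\rangle_{\beta,-s}$, and their squared norms are $$\big\langle\mathsf S_{m,\ell}^{n,(\beta,-s)},\mathsf S_{m,\ell}^{n,(\beta,-s)}\big\rangle_{\beta,-s}=\begin{cases}2^{2n-2m}\,\lambda_{n-m},&0\le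 n-m\le s-1,\\[1mm]2^{\,s-\beta-2m-d}\;\widehat h_{n-m-s}^{(s+2m+\beta+d-1,0)},&n-m\ge s,\end{cases}$$ where $$\widehat h_n^{(\alpha,\gamma)}=\frac{2^{\alpha+\gamma+1}}{c_{\alpha,\gamma}}\big[A_n^{(\alpha,\gamma)}\big]^2h_n^{(\alpha,\gamma)},\qquad c_{\alpha,\gamma}=\frac{\Gamma(\alpha+\gamma+2)}{\Gamma(\alpha+1)\Gamma(\gamma+1)},$$ $h_0^{(\alpha,\gamma)}=1$, and for $n\ge 1$ $$h_n^{(\alpha,\gamma)}=\frac{(\alpha+1)_n(\gamma+1)_n(\alpha+\gamma+n+1)}{n!\,(\alpha+\gamma+2)_n(\alpha+\gamma+2n+1)}.$$ -/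

import Mathlib

open MvPolynomial MeasureTheory

noncomputable section

namespace SobolevCone

/-! ### The coordinate ring of the cone `‖x‖ = t` and the derivative `∂_t` on it -/

/-- Polynomials in `x_1, …, x_d` and `t`: the variable `i.castSucc` is `x_i`, the last variable
is `t`. -/
abbrev Ambient (d : ℕ) : Type := MvPolynomial (Fin (d + 1)) ℝ

/-- The polynomial `t ^ 2 - ‖x‖ ^ 2`. -/
def quadric (d : ℕ) : Ambient d :=
  X (Fin.last d) ^ 2 - ∑ i : Fin d, X i.castSucc ^ 2

/-- The ideal generated by `t ^ 2 - ‖x‖ ^ 2`. -/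
def coneIdeal (d : ℕ) : Ideal (Ambient d) := Ideal.span {quadric d}

/-- Polynomials on the cone: `ℝ[x, t] / ⟨t ^ 2 - ‖x‖ ^ 2⟩`. -/
abbrev ConeRing (d : ℕ) : Type := Ambient d ⧸ coneIdeal d

/-- The class of a polynomial in `ℝ[x, t] / ⟨t ^ 2 - ‖x‖ ^ 2⟩`. -/
def toCone (d : ℕ) : Ambient d →ₐ[ℝ] ConeRing d := Ideal.Quotient.mkₐ ℝ (coneIdeal d)

/-- The Laplace operator in the `x` variables, acting on `ℝ[x, t]`. -/
def laplaceX (d : ℕ) : Ambient d →ₗ[ℝ] Ambient d :=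
  ∑ i : Fin d, (pderiv i.castSucc).toLinearMap ∘ₗ (pderiv i.castSucc).toLinearMap

/-- The space of the polynomials `F(x, t)` that are harmonic in `x` for each `t`. -/
def xHarmonic (d : ℕ) : Submodule ℝ (Ambient d) := LinearMap.ker (laplaceX d)

/-- The Euler operator `∑ x_i ∂/∂x_i` on `ℝ[x, t]` (auxiliary). -/
def eulerX (d : ℕ) : Ambient d →ₗ[ℝ] Ambient d :=
  ∑ i : Fin d, LinearMap.mulLeft ℝ (X i.castSucc) ∘ₗ (pderiv i.castSucc).toLinearMap

theorem laplaceX_apply (d : ℕ) (g : Ambient d) :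
    laplaceX d g = ∑ i : Fin d, pderiv i.castSucc (pderiv i.castSucc g) := by
  simp [laplaceX]

theorem eulerX_apply (d : ℕ) (g : Ambient d) :
    eulerX d g = ∑ i : Fin d, X i.castSucc * pderiv i.castSucc g := by
  simp [eulerX]

theorem pderiv_quadric (d : ℕ) (i : Fin d) :
    pderiv i.castSucc (quadric d) = - (2 * X i.castSucc) := by
  have h : ∀ j : Fin d, pderiv i.castSucc ((X j.castSucc : Ambient d) ^ 2)
      = if j = i then 2 * X i.castSucc else 0 := by
    intro j
    by_cases hj : j = i
    · subst hj; simp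
    · have : j.castSucc ≠ i.castSucc := fun h => hj (Fin.castSucc_injective d h)
      simp [pderiv_X_of_ne this, hj]
  have hl : pderiv i.castSucc (X (Fin.last d) : Ambient d) = 0 :=
    pderiv_X_of_ne (Fin.castSucc_lt_last i).ne'
  simp [quadric, h, hl]

theorem laplaceX_quadric_mul (d : ℕ) (g : Ambient d) :
    laplaceX d (quadric d * g)
      = quadric d * laplaceX d g - 4 * eulerX d g - C (2 * (d : ℝ)) * g := by
  have h2 : ∀ i : Fin d, pderiv i.castSucc (2 : Ambient d) = 0 := fun i => by
    have : (2 : Ambient d) = C 2 := (map_ofNat C 2).symm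
    rw [this, pderiv_C]
  have h : ∀ i : Fin d, pderiv i.castSucc (pderiv i.castSucc (quadric d * g))
      = quadric d * pderiv i.castSucc (pderiv i.castSucc g)
        - 4 * (X i.castSucc * pderiv i.castSucc g) - 2 * g := by
    intro i
    simp only [pderiv_mul, pderiv_quadric, map_add, map_neg, h2, pderiv_X_self]
    ring
  rw [laplaceX_apply, Finset.sum_congr rfl fun i _ => h i]
  simp only [Finset.sum_sub_distrib, ← Finset.mul_sum, laplaceX_apply, eulerX_apply]
  simp only [Finset.sum_const, Finset.card_univ, Fintype.card_fin, nsmul_eq_mul, map_mul,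
    map_natCast, map_ofNat]
  ring

theorem pderiv_comm_aux (d : ℕ) (i j : Fin (d + 1)) (g : Ambient d) :
    pderiv i (pderiv j g) = pderiv j (pderiv i g) := by
  have h : ⁅(pderiv i : Derivation ℝ (Ambient d) (Ambient d)),
      (pderiv j : Derivation ℝ (Ambient d) (Ambient d))⁆ = 0 := by
    classical
    refine MvPolynomial.derivation_ext fun k => ?_
    rw [Derivation.commutator_apply, pderiv_X, pderiv_X]
    by_cases h1 : k = i <;> by_cases h2 : k = j <;> simp [Pi.single_apply, h1, h2] <;>
      split_ifs <;> simp
  have h' := congrArg (fun D => D g) h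
  simpa [Derivation.commutator_apply, sub_eq_zero] using h'

theorem pderiv_eulerX (d : ℕ) (i : Fin d) (g : Ambient d) :
    pderiv i.castSucc (eulerX d g) = eulerX d (pderiv i.castSucc g) + pderiv i.castSucc g := by
  have h : ∀ j : Fin d, pderiv i.castSucc (X j.castSucc * pderiv j.castSucc g)
      = X j.castSucc * pderiv j.castSucc (pderiv i.castSucc g)
        + if j = i then pderiv i.castSucc g else 0 := by
    intro j
    rw [pderiv_mul, pderiv_comm_aux d i.castSucc j.castSucc]
    by_cases hj : j = i
    · subst hj; simp [add_comm]
    · have : j.castSucc ≠ i.castSucc := fun h => hj (Fin.castSucc_injective d h)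
      simp [pderiv_X_of_ne this, hj]
  rw [eulerX_apply, map_sum, Finset.sum_congr rfl fun j _ => h j, Finset.sum_add_distrib,
    eulerX_apply]
  simp

theorem laplaceX_eulerX (d : ℕ) (g : Ambient d) :
    laplaceX d (eulerX d g) = eulerX d (laplaceX d g) + 2 * laplaceX d g := by
  simp only [laplaceX_apply, pderiv_eulerX, map_add, Finset.sum_add_distrib, map_sum]
  ring

theorem coeff_eulerX (d : ℕ) (g : Ambient d) (m : Fin (d + 1) →₀ ℕ) :
    coeff m (eulerX d g) = (∑ i : Fin d, (m i.castSucc : ℝ)) * coeff m g := by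
  induction g using MvPolynomial.induction_on' with
  | monomial u r =>
    have : eulerX d (monomial u r) = (∑ i : Fin d, (u i.castSucc : ℝ)) • monomial u r := by
      simp only [eulerX_apply, X_mul_pderiv_monomial, Finset.sum_smul, Nat.cast_smul_eq_nsmul]
    rw [this, coeff_smul, smul_eq_mul]
    by_cases h : u = m
    · subst h; rfl
    · simp [coeff_monomial, h]
  | add p q hp hq => simp [hp, hq, mul_add]

theorem eulerX_add_const_injective (d : ℕ) {a c : ℝ} (ha : 0 ≤ a) (hc : 0 < c) {g : Ambient d}
    (h : a • eulerX d g + c • g = 0) : g = 0 := by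
  ext m
  have h' := congrArg (coeff m) h
  simp only [coeff_add, coeff_smul, smul_eq_mul, coeff_eulerX, coeff_zero] at h' ⊢
  have hs : 0 ≤ ∑ i : Fin d, (m i.castSucc : ℝ) := Finset.sum_nonneg fun i _ => by positivity
  have hpos : a * (∑ i : Fin d, (m i.castSucc : ℝ)) + c ≠ 0 := by positivity
  have : (a * (∑ i : Fin d, (m i.castSucc : ℝ)) + c) * coeff m g = 0 := by linarith
  exact (mul_eq_zero.1 this).resolve_left hpos

theorem eulerX_add_const_surjective (d : ℕ) {a c : ℝ} (ha : 0 ≤ a) (hc : 0 < c)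
    (q : Ambient d) : ∃ g : Ambient d, a • eulerX d g + c • g = q := by
  induction q using MvPolynomial.induction_on' with
  | monomial u r =>
    have hs : 0 ≤ ∑ i : Fin d, (u i.castSucc : ℝ) := Finset.sum_nonneg fun i _ => by positivity
    have hpos : a * (∑ i : Fin d, (u i.castSucc : ℝ)) + c ≠ 0 := by positivity
    refine ⟨monomial u ((a * (∑ i : Fin d, (u i.castSucc : ℝ)) + c)⁻¹ * r), ?_⟩
    ext m
    simp only [coeff_add, coeff_smul, smul_eq_mul, coeff_eulerX, coeff_monomial]
    by_cases h : u = m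
    · subst h
      simp only [if_true]
      field_simp
    · simp [h]
  | add p q hp hq =>
    obtain ⟨g, hg⟩ := hp
    obtain ⟨g', hg'⟩ := hq
    exact ⟨g + g', by rw [map_add, ← hg, ← hg']; module⟩

theorem laplaceX_nilpotent_of_homogeneous (d : ℕ) :
    ∀ (n : ℕ) (g : Ambient d), g.IsHomogeneous n → ∃ N : ℕ, (laplaceX d ^ N) g = 0 := by
  intro n
  induction n using Nat.strong_induction_on with
  | _ n ih =>
    intro g hg
    rcases Nat.eq_zero_or_pos n with rfl | hn
    · refine ⟨1, ?_⟩
      have : g = C (coeff 0 g) :=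
        totalDegree_eq_zero_iff_eq_C.1 (Nat.le_zero.1 hg.totalDegree_le)
      rw [this]
      simp [laplaceX_apply]
    · obtain ⟨N, hN⟩ := ih (n - 1 - 1) (by omega) (laplaceX d g) (by
        rw [laplaceX_apply]
        exact IsHomogeneous.sum _ _ _ fun i _ => hg.pderiv.pderiv)
      exact ⟨N + 1, by rw [pow_succ]; exact hN⟩

theorem laplaceX_nilpotent (d : ℕ) (g : Ambient d) : ∃ N : ℕ, (laplaceX d ^ N) g = 0 := by
  induction g using MvPolynomial.induction_on' with
  | monomial u r =>
    exact laplaceX_nilpotent_of_homogeneous d _ _ (isHomogeneous_monomial r rfl)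
  | add p q hp hq =>
    obtain ⟨N, hN⟩ := hp
    obtain ⟨M, hM⟩ := hq
    refine ⟨N + M, ?_⟩
    have h1 : (laplaceX d ^ (N + M)) p = 0 := by
      rw [Nat.add_comm N M, pow_add, Module.End.mul_apply, hN, map_zero]
    have h2 : (laplaceX d ^ (N + M)) q = 0 := by
      rw [pow_add, Module.End.mul_apply, hM, map_zero]
    rw [map_add, h1, h2, add_zero]

theorem laplaceX_transport (d : ℕ) (a c : ℝ) (g u : Ambient d) :
    laplaceX d (a • eulerX d g + c • g - quadric d * u)
      = (a • eulerX d (laplaceX d g) + (2 * a + c) • laplaceX d g)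
        + ((4 : ℝ) • eulerX d u + (2 * (d : ℝ)) • u) - quadric d * laplaceX d u := by
  rw [map_sub, map_add, map_smul, map_smul, laplaceX_eulerX, laplaceX_quadric_mul]
  simp only [smul_eq_C_mul, map_add, map_mul, map_natCast, map_ofNat]
  ring

theorem existence_aux (d : ℕ) : ∀ (N : ℕ) (a c : ℝ), 0 ≤ a → 0 < c → ∀ q : Ambient d,
    (laplaceX d ^ N) q = 0 →
    ∃ g, a • eulerX d g + c • g - quadric d * laplaceX d g = q := by
  intro N
  induction N with
  | zero =>
    intro a c _ _ q hq
    refine ⟨0, ?_⟩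
    have : q = 0 := by simpa using hq
    simp [this]
  | succ N ih =>
    intro a c ha hc q hq
    obtain ⟨u, hu⟩ := ih (a + 4) (2 * a + c + 2 * d) (by positivity) (by positivity)
      (laplaceX d q) (by rw [pow_succ] at hq; exact hq)
    obtain ⟨g, hg⟩ := eulerX_add_const_surjective d ha hc (q + quadric d * u)
    have hg' : a • eulerX d g + c • g - quadric d * u = q := by rw [hg]; ring
    have key := laplaceX_transport d a c g u
    rw [hg', ← hu] at key
    have : laplaceX d g - u = 0 := by
      refine eulerX_add_const_injective d ha (show 0 < 2 * a + c by positivity) ?_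
      rw [map_sub]
      have h0 := sub_eq_zero.2 key
      rw [← neg_eq_zero, ← h0]
      module
    exact ⟨g, by rw [sub_eq_zero.1 this]; exact hg'⟩

theorem uniqueness_aux (d : ℕ) : ∀ (N : ℕ) (a c : ℝ), 0 ≤ a → 0 < c → ∀ g : Ambient d,
    (laplaceX d ^ N) g = 0 →
    a • eulerX d g + c • g - quadric d * laplaceX d g = 0 → g = 0 := by
  intro N
  induction N with
  | zero =>
    intro a c _ _ g hg _
    simpa using hg
  | succ N ih =>
    intro a c ha hc g hg h
    have key := laplaceX_transport d a c g (laplaceX d g)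
    rw [h, map_zero] at key
    have : laplaceX d g = 0 := by
      refine ih (a + 4) (2 * a + c + 2 * d) (by positivity) (by positivity) _
        (by rw [pow_succ] at hg; exact hg) ?_
      rw [key]
      module
    rw [this, mul_zero, sub_zero] at h
    exact eulerX_add_const_injective d ha hc h

/-- Every class in `ℝ[x, t] / ⟨t ^ 2 - ‖x‖ ^ 2⟩` has exactly one representative that is harmonic
in `x`. -/
theorem bijective_toCone_xHarmonic (d : ℕ) [NeZero d] :
    Function.Bijective ((toCone d).toLinearMap.domRestrict (xHarmonic d)) := by
  have hd : (0 : ℝ) < 2 * (d : ℝ) := by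
    have : 0 < d := Nat.pos_of_ne_zero (NeZero.ne d)
    positivity
  constructor
  · rw [injective_iff_map_eq_zero]
    rintro ⟨F, hF⟩ h
    have hm : F ∈ coneIdeal d := Ideal.Quotient.eq_zero_iff_mem.1 h
    obtain ⟨g, rfl⟩ := Ideal.mem_span_singleton'.1 hm
    have hF' : laplaceX d (g * quadric d) = 0 := hF
    rw [mul_comm, laplaceX_quadric_mul] at hF'
    obtain ⟨N, hN⟩ := laplaceX_nilpotent d g
    have : g = 0 := by
      refine uniqueness_aux d N 4 (2 * d) (by norm_num) hd g hN ?_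
      rw [← neg_eq_zero, ← hF']
      simp only [smul_eq_C_mul, map_ofNat]
      ring
    ext1
    simp [this]
  · intro q
    obtain ⟨p, rfl⟩ := Ideal.Quotient.mk_surjective q
    obtain ⟨N, hN⟩ := laplaceX_nilpotent d (- laplaceX d p)
    obtain ⟨g, hg⟩ := existence_aux d N 4 (2 * d) (by norm_num) hd _ hN
    refine ⟨⟨p - quadric d * g, ?_⟩, ?_⟩
    · change laplaceX d (p - quadric d * g) = 0
      rw [map_sub, laplaceX_quadric_mul]
      have : laplaceX d p = -((4 : ℝ) • eulerX d g + (2 * (d : ℝ)) • g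
          - quadric d * laplaceX d g) := by rw [hg, neg_neg]
      rw [this]
      simp only [smul_eq_C_mul, map_ofNat]
      ring
    · change Ideal.Quotient.mk (coneIdeal d) (p - quadric d * g) = Ideal.Quotient.mk _ p
      rw [Ideal.Quotient.eq, sub_sub_cancel_left, neg_mem_iff]
      exact Ideal.mul_mem_right _ _ (Ideal.subset_span rfl)

/-- The representative of a polynomial on the cone that is harmonic in `x`. -/
def harmonicRep (d : ℕ) [NeZero d] : ConeRing d ≃ₗ[ℝ] xHarmonic d :=
  (LinearEquiv.ofBijective _ (bijective_toCone_xHarmonic d)).symm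

/-- The operator `∂_t` on polynomials on the cone: the partial derivative with respect to `t`
(`x` being fixed) of the representative that is harmonic in `x`. Equivalently, `∂_t` is the linear
operator with `∂_t (p(t) Y(x)) = p'(t) Y(x)` for every polynomial `p` and every solid harmonic `Y`.
(The partial derivative in `t` does not preserve the ideal `⟨t ^ 2 - ‖x‖ ^ 2⟩`, so that a
representative has to be fixed.) -/
def dt (d : ℕ) [NeZero d] : ConeRing d →ₗ[ℝ] ConeRing d :=
  (toCone d).toLinearMap ∘ₗ (pderiv (Fin.last d)).toLinearMap ∘ₗ (xHarmonic d).subtype ∘ₗ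
    (harmonicRep d).toLinearMap

theorem dt_toCone (d : ℕ) [NeZero d] (F : Ambient d) (hF : F ∈ xHarmonic d) :
    dt d (toCone d F) = toCone d (pderiv (Fin.last d) F) := by
  have : harmonicRep d (toCone d F) = ⟨F, hF⟩ := by
    rw [harmonicRep, LinearEquiv.symm_apply_eq]
    rfl
  simp [dt, this]

/-- The value at the point `(t ξ, t)` of a polynomial on the cone, for `ξ` in the unit sphere. -/
def coneEval (d : ℕ) (t : ℝ) (ξ : Metric.sphere (0 : EuclideanSpace ℝ (Fin d)) 1) :
    ConeRing d →ₐ[ℝ] ℝ :=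
  Ideal.Quotient.liftₐ (coneIdeal d)
    (aeval (Fin.snoc (fun i : Fin d => t * ξ.1 i) t : Fin (d + 1) → ℝ)) (by
      intro a ha
      obtain ⟨g, rfl⟩ := Ideal.mem_span_singleton'.1 ha
      have hξ : ∑ i : Fin d, (ξ.1 i) ^ 2 = 1 := by
        have h := EuclideanSpace.real_norm_sq_eq ξ.1
        rw [norm_eq_of_mem_sphere ξ] at h
        linarith
      simp [quadric, mul_pow, ← Finset.mul_sum, hξ])

/-- The classes of the polynomials of total degree at most `n`. -/
def conePolys (d n : ℕ) : Submodule ℝ (ConeRing d) :=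
  (restrictTotalDegree (Fin (d + 1)) ℝ n).map (toCone d).toLinearMap

/-! ### Solid harmonics and integration over the sphere and the cone -/

/-- The space `ℋ_m^{d,0}` of homogeneous harmonic polynomials of degree `m` in `d` variables. -/
def solidHarmonics (d m : ℕ) : Submodule ℝ (MvPolynomial (Fin d) ℝ) :=
  homogeneousSubmodule (Fin d) ℝ m ⊓
    LinearMap.ker (∑ i : Fin d, (pderiv i).toLinearMap ∘ₗ (pderiv i).toLinearMap :
      MvPolynomial (Fin d) ℝ →ₗ[ℝ] MvPolynomial (Fin d) ℝ)

/-- `∂_t (p(t) Y(x)) = p'(t) Y(x)` for a solid harmonic `Y`. -/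
theorem dt_mul_solidHarmonic (d : ℕ) [NeZero d] {m : ℕ} (p : Polynomial ℝ)
    (Y : MvPolynomial (Fin d) ℝ) (hY : Y ∈ solidHarmonics d m) :
    dt d (toCone d (Polynomial.aeval (X (Fin.last d) : Ambient d) p * rename Fin.castSucc Y))
      = toCone d (Polynomial.aeval (X (Fin.last d) : Ambient d) p.derivative *
          rename Fin.castSucc Y) := by
  have hl : ∀ i : Fin d, pderiv i.castSucc (Polynomial.aeval (X (Fin.last d) : Ambient d) p) = 0 :=
    fun i => by
      rw [Derivation.map_aeval, pderiv_X_of_ne (Fin.castSucc_lt_last i).ne', smul_zero]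
  have hr : pderiv (Fin.last d) (rename Fin.castSucc Y : Ambient d) = 0 := by
    classical
    refine pderiv_eq_zero_of_notMem_vars fun h => ?_
    obtain ⟨i, -, hi⟩ := Finset.mem_image.1 (vars_rename Fin.castSucc Y h)
    exact (Fin.castSucc_lt_last i).ne hi
  have hΔ : ∑ i : Fin d, pderiv i (pderiv i Y) = 0 := by
    have h := hY.2
    simpa using h
  rw [dt_toCone]
  · rw [pderiv_mul, hr, mul_zero, add_zero, Derivation.map_aeval, pderiv_X_self, smul_eq_mul,
      mul_one]
  · change laplaceX d _ = 0
    rw [laplaceX_apply]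
    simp only [pderiv_mul, hl, zero_mul, zero_add, pderiv_rename (Fin.castSucc_injective d)]
    rw [← Finset.mul_sum, ← map_sum, hΔ, map_zero, mul_zero]

/-- Integration with respect to the surface measure `dσ` of the unit sphere. -/
def sphereIntegral (d : ℕ) (f : Metric.sphere (0 : EuclideanSpace ℝ (Fin d)) 1 → ℝ) : ℝ :=
  ∫ ξ, f ξ ∂(volume : Measure (EuclideanSpace ℝ (Fin d))).toSphere

/-- The surface area `ω_d` of the unit sphere. -/
def sphereArea (d : ℕ) : ℝ :=
  (volume : Measure (EuclideanSpace ℝ (Fin d))).toSphere.real Set.univ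

/-- Integration over the cone `{(x, t) : ‖x‖ = t, 0 ≤ t ≤ 1}` with respect to `dm`, of a function
written as a function of `t` and `ξ`, where `(x, t) = (t ξ, t)`. -/
def coneIntegral (d : ℕ) (f : ℝ → Metric.sphere (0 : EuclideanSpace ℝ (Fin d)) 1 → ℝ) : ℝ :=
  ∫ t in (0 : ℝ)..1, t ^ (d - 1) * sphereIntegral d (f t)

/-- The normalized inner product of `L ^ 2` of the sphere, for polynomials. -/
def sphereInner (d : ℕ) (p q : MvPolynomial (Fin d) ℝ) : ℝ :=
  (1 / sphereArea d) * sphereIntegral d (fun ξ => eval (fun i => ξ.1 i) p * eval (fun i => ξ.1 i) q)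

/-- The Sobolev inner product `⟨f, g⟩_{β,-s}` with parameters `lam 0, …, lam (s - 1)`. -/
def sobolevInner (d : ℕ) [NeZero d] (s : ℕ) (β : ℝ) (lam : ℕ → ℝ) (f g : ConeRing d) : ℝ :=
  (1 / sphereArea d) * coneIntegral d (fun t ξ =>
      coneEval d t ξ ((dt d ^ s) f) * coneEval d t ξ ((dt d ^ s) g) * t ^ (β + (s : ℝ)))
    + ∑ k ∈ Finset.range s, (lam k / sphereArea d) * sphereIntegral d (fun ξ =>
      coneEval d 1 ξ ((dt d ^ k) f) * coneEval d 1 ξ ((dt d ^ k) g))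

/-- `𝒱_n^d(w_{β,-s})`: the polynomials on the cone of degree at most `n` that are orthogonal to all
polynomials of lower degree. -/
def orthogonalPolys (d : ℕ) [NeZero d] (s : ℕ) (β : ℝ) (lam : ℕ → ℝ) (n : ℕ) :
    Set (ConeRing d) :=
  {f | f ∈ conePolys d n ∧
    ∀ k < n, ∀ g ∈ conePolys d k, sobolevInner d s β lam f g = 0}

/-! ### Jacobi polynomials -/

/-- The Pochhammer symbol `(a)_n = a (a + 1) ⋯ (a + n - 1)`. -/
def poch (a : ℝ) (n : ℕ) : ℝ := (ascPochhammer ℝ n).eval a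

/-- The Jacobi polynomial `P_n^{(α,β)}`, through its hypergeometric expansion at `1`. -/
def jacobi (α β : ℝ) (n : ℕ) : Polynomial ℝ :=
  Polynomial.C (poch (α + 1) n / n.factorial) *
    ∑ k ∈ Finset.range (n + 1),
      Polynomial.C (poch (-n) k * poch (n + α + β + 1) k / (poch (α + 1) k * k.factorial)) *
        (Polynomial.C (1 / 2) * (1 - Polynomial.X)) ^ k

/-- The constant `A_n^{(α,β)} = 2 ^ n / (n + α + β + 1)_n`. -/
def jacobiA (α β : ℝ) (n : ℕ) : ℝ := 2 ^ n / poch (n + α + β + 1) n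

/-- The renormalized Jacobi polynomial `A_n^{(α,β)} P_n^{(α,β)}`. -/
def jacobiHat (α β : ℝ) (n : ℕ) : Polynomial ℝ :=
  Polynomial.C (jacobiA α β n) * jacobi α β n

/-- The constant `c_{α,β}` that normalizes the weight `(1 - t) ^ α (1 + t) ^ β`. -/
def jacobiC (α β : ℝ) : ℝ :=
  Real.Gamma (α + β + 2) / (Real.Gamma (α + 1) * Real.Gamma (β + 1))

/-- The squared norm `h_n^{(α,β)}` of `P_n^{(α,β)}` for the normalized weight. -/
def jacobiH (α β : ℝ) (n : ℕ) : ℝ :=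
  if n = 0 then 1 else
    poch (α + 1) n * poch (β + 1) n * (α + β + n + 1) /
      (n.factorial * poch (α + β + 2) n * (α + β + 2 * n + 1))

/-- The squared norm of the renormalized Jacobi polynomial of degree `n` for the weight
`(1 - t) ^ α (1 + t) ^ β`. -/
def jacobiHatH (α β : ℝ) (n : ℕ) : ℝ :=
  2 ^ (α + β + 1) / jacobiC α β * jacobiA α β n ^ 2 * jacobiH α β n

/-- The antiderivative of a polynomial that vanishes at `-1`. -/
def antideriv (p : Polynomial ℝ) : Polynomial ℝ :=
  let q : Polynomial ℝ := p.sum fun k a => Polynomial.monomial (k + 1) (a / (k + 1))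
  q - Polynomial.C (q.eval (-1))

/-- The polynomial `J_n^{(α-s,β-s)}`: it is `(t + 1) ^ n / n!` for `n < s`, and for `n ≥ s` the
`s`-fold antiderivative at `-1`, that is
`∫_{-1}^t (t - u) ^ (s - 1) / (s - 1)! * (jacobiHat α β (n - s))(u) du`
(see `eval_sobolevJacobi`), of the renormalized Jacobi polynomial of degree `n - s`.
The arguments `α`, `β` here are the unshifted ones. -/
def sobolevJacobi (α β : ℝ) (s n : ℕ) : Polynomial ℝ :=
  if n < s then Polynomial.C (1 / (n.factorial : ℝ)) * (Polynomial.X + 1) ^ n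
  else antideriv^[s] (jacobiHat α β (n - s))

theorem derivative_antideriv (p : Polynomial ℝ) : (antideriv p).derivative = p := by
  simp only [antideriv, Polynomial.derivative_sub, Polynomial.derivative_C, sub_zero]
  rw [Polynomial.sum, Polynomial.derivative_sum]
  conv_rhs => rw [p.as_sum_support]
  refine Finset.sum_congr rfl fun k _ => ?_
  rw [Polynomial.derivative_monomial]
  have : ((k : ℝ) + 1) ≠ 0 := by positivity
  simp [this]

theorem eval_antideriv_neg_one (p : Polynomial ℝ) : (antideriv p).eval (-1) = 0 := by
  simp [antideriv]

theorem eval_antideriv (p : Polynomial ℝ) (t : ℝ) :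
    (antideriv p).eval t = ∫ u in (-1 : ℝ)..t, p.eval u := by
  have h : ∀ u, HasDerivAt (fun u => (antideriv p).eval u) (p.eval u) u := fun u => by
    simpa [derivative_antideriv] using (antideriv p).hasDerivAt u
  rw [intervalIntegral.integral_eq_sub_of_hasDerivAt (fun u _ => h u)
    (p.continuous.intervalIntegrable _ _), eval_antideriv_neg_one, sub_zero]

theorem eval_iterate_antideriv (s : ℕ) : ∀ (p : Polynomial ℝ) (t : ℝ),
    (antideriv^[s + 1] p).eval t
      = ∫ u in (-1 : ℝ)..t, (t - u) ^ s / s.factorial * p.eval u := by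
  induction s with
  | zero => intro p t; simp [eval_antideriv]
  | succ s ih =>
    intro p t
    rw [Function.iterate_succ_apply, ih]
    have hu : ∀ u ∈ Set.uIcc (-1 : ℝ) t, HasDerivAt
        (fun u : ℝ => (t - u) ^ (s + 1) / ((s + 1).factorial : ℝ))
        (-((t - u) ^ s / (s.factorial : ℝ))) u := by
      intro u _
      have h1 : HasDerivAt (fun u : ℝ => t - u) (-1) u := by
        simpa using (hasDerivAt_id u).const_sub t
      have h2 := (h1.pow (s + 1)).div_const ((s + 1).factorial : ℝ)
      refine h2.congr_deriv ?_
      rw [Nat.factorial_succ]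
      have : (s.factorial : ℝ) ≠ 0 := by positivity
      push_cast
      have h3 : (s : ℝ) + 1 ≠ 0 := by positivity
      field_simp
    have hv : ∀ u ∈ Set.uIcc (-1 : ℝ) t, HasDerivAt
        (fun u : ℝ => (antideriv p).eval u) (p.eval u) u := fun u _ => by
      simpa [derivative_antideriv] using (antideriv p).hasDerivAt u
    have hc : Continuous fun u : ℝ => -((t - u) ^ s / (s.factorial : ℝ)) := by fun_prop
    have key := intervalIntegral.integral_mul_deriv_eq_deriv_mul hu hv
      (hc.intervalIntegrable _ _) (p.continuous.intervalIntegrable _ _)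
    rw [key]
    simp [eval_antideriv_neg_one]

/-- The integral formula for `J_n^{(α-s,β-s)}`, `n ≥ s`. -/
theorem eval_sobolevJacobi (α β : ℝ) {s n : ℕ} (hs : 0 < s) (hn : s ≤ n) (t : ℝ) :
    (sobolevJacobi α β s n).eval t = ∫ u in (-1 : ℝ)..t,
      (t - u) ^ (s - 1) / (s - 1).factorial * (jacobiHat α β (n - s)).eval u := by
  obtain ⟨r, rfl⟩ : ∃ r, s = r + 1 := ⟨s - 1, by omega⟩
  rw [sobolevJacobi, if_neg (by omega), eval_iterate_antideriv]
  rfl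

/-! ### The polynomials on the cone -/

/-- `S^n_m(x, t) = J_{n-m}^{(2m+β+d-1,-s)}(1 - 2t) Y(x)` as a polynomial on the cone; the upper
parameters of `J` are `α - s` and `0 - s` with `α = s + 2m + β + d - 1`. -/
def sobolevS (d s : ℕ) (β : ℝ) (n m : ℕ) (Y : MvPolynomial (Fin d) ℝ) : ConeRing d :=
  toCone d
    (Polynomial.aeval (1 - 2 * X (Fin.last d) : Ambient d)
        (sobolevJacobi (s + 2 * m + β + d - 1) 0 s (n - m)) *
      rename Fin.castSucc Y)

end SobolevCone

end

noncomputable section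

namespace SobolevCone

/-! ### Gaussian integrals of polynomials -/

/-! Everything reduces to products `p(t) Y(x)` with `Y` a solid harmonic of degree `m`. On such a
product `∂_t` differentiates `p` alone, and its value at `(tξ, t)` is `t ^ m p(t) Y(ξ)`. Hence the
Sobolev form of two products factors into the sphere inner product of the harmonics and a
one-variable Sobolev form with weight `t ^ (s + m + m' + β + d - 1)` on `[0, 1]`
(`sobolevInner_coneTerm`).

For `m ≠ m'` the sphere factor vanishes (`sphereInner_eq_zero`); this is obtained from integration
by parts against a Gaussian and polar coordinates. For `m = m'` the weight exponent is the Jacobi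
parameter of the profiles `J_j(1 - 2t)`. The `s`-th derivative of a profile is zero or a multiple of
`P^{(α,0)}(1 - 2t)`, and these polynomials are orthogonal for `t ^ α`. Its derivatives of order `k <
s` at `t = 1`, that is at argument `-1`, vanish unless `k` is the index of the profile. So the
one-variable form is diagonal on the profiles (`intervalForm_sobolevProfile_of_ne`,
`intervalForm_sobolevProfile_self`). The Jacobi orthogonality and norms are explicit alternating
binomial sums (`powerMoment_shiftedJacobi_mul_X_pow`).

For completeness, a homogeneous polynomial in `x` is a solid harmonic plus a multiple of `‖x‖ ^ 2`,
which is `t ^ 2` on the cone; thus the products `t ^ b Y(x)` span (`conePolys_le`), and `t ^ b`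
expands in the profiles, one of each degree. An orthogonal family with nonzero squares that spans
the polynomials of each degree bound then spans the spaces `𝒱_n` by its members of index `n`
(`mem_span_image_of_orthogonal`). -/

theorem continuous_eval_euclidean {d : ℕ} (p : MvPolynomial (Fin d) ℝ) :
    Continuous fun x : EuclideanSpace ℝ (Fin d) => eval (fun i => x i) p :=
  p.continuous_eval.comp (PiLp.continuous_ofLp 2 _)

theorem hasFDerivAt_eval_euclidean {d : ℕ} (p : MvPolynomial (Fin d) ℝ)
    (x : EuclideanSpace ℝ (Fin d)) :
    HasFDerivAt (fun x : EuclideanSpace ℝ (Fin d) => eval (fun i => x i) p)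
      (∑ i, eval (fun i => x i) (pderiv i p) •
        (EuclideanSpace.proj i : EuclideanSpace ℝ (Fin d) →L[ℝ] ℝ)) x := by
  induction p using MvPolynomial.induction_on with
  | C a => simpa using hasFDerivAt_const a x
  | add p q hp hq =>
    simp only [map_add, add_smul, Finset.sum_add_distrib]
    exact hp.add hq
  | mul_X p j hp =>
    have hj : HasFDerivAt (fun x : EuclideanSpace ℝ (Fin d) => x j)
        (EuclideanSpace.proj j : EuclideanSpace ℝ (Fin d) →L[ℝ] ℝ) x :=
      (EuclideanSpace.proj j : EuclideanSpace ℝ (Fin d) →L[ℝ] ℝ).hasFDerivAt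
    have h := hp.mul hj
    simp only [map_mul, eval_X]
    refine h.congr_fderiv ?_
    ext v
    have h1 : ∀ i, eval (fun i => x i) (pderiv i (p * X j)) * v i
        = (if i = j then eval (fun i => x i) p * v i else 0)
          + x j * (eval (fun i => x i) (pderiv i p) * v i) := by
      intro i
      rw [pderiv_mul, pderiv_X]
      by_cases hij : i = j
      · subst hij
        simp
        ring
      · simp [hij, Ne.symm hij]
        ring
    trans ∑ i, eval (fun i => x i) (pderiv i (p * X j)) * v i
    · simp only [h1, Finset.sum_add_distrib]
      simp [Finset.mul_sum]
    · simp only [_root_.sum_apply, smul_apply, smul_eq_mul]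
      rfl

/-- Coordinates are bounded by the norm, so a monomial is dominated by a power of `‖x‖`, and the
radial integral is a one-dimensional Gaussian moment. -/
theorem integrable_eval_mul_gaussian {d : ℕ} [NeZero d] (p : MvPolynomial (Fin d) ℝ) :
    Integrable fun x : EuclideanSpace ℝ (Fin d) =>
      eval (fun i => x i) p * Real.exp (-‖x‖ ^ 2) := by
  induction p using MvPolynomial.induction_on' with
  | add p q hp hq =>
    simp only [map_add, add_mul]
    exact hp.add hq
  | monomial u r =>
    have hn : Integrable fun x : EuclideanSpace ℝ (Fin d) =>
        |r| * (‖x‖ ^ u.degree * Real.exp (-‖x‖ ^ 2)) := by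
      refine Integrable.const_mul ?_ _
      refine (integrable_fun_norm_addHaar volume
        (f := fun t : ℝ => t ^ u.degree * Real.exp (-t ^ 2))).2 ?_
      have h := integrableOn_rpow_mul_exp_neg_mul_sq (b := 1) one_pos
        (s := ((Module.finrank ℝ (EuclideanSpace ℝ (Fin d)) - 1 + u.degree : ℕ) : ℝ))
        (lt_of_lt_of_le (by norm_num) (Nat.cast_nonneg _))
      refine h.congr_fun (fun t _ => ?_) measurableSet_Ioi
      simp only [Real.rpow_natCast, pow_add, smul_eq_mul]
      ring_nf
    refine hn.mono' ((continuous_eval_euclidean _).mul (by fun_prop)).aestronglyMeasurable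
      (Filter.Eventually.of_forall fun x => ?_)
    rw [norm_mul, Real.norm_of_nonneg (Real.exp_pos _).le, ← mul_assoc]
    refine mul_le_mul_of_nonneg_right ?_ (Real.exp_pos _).le
    rw [eval_monomial, norm_mul, Real.norm_eq_abs]
    refine mul_le_mul_of_nonneg_left ?_ (abs_nonneg r)
    rw [Finsupp.prod, norm_prod, Finsupp.degree_apply, ← Finset.prod_pow_eq_pow_sum]
    refine Finset.prod_le_prod (fun _ _ => norm_nonneg _) fun i _ => ?_
    rw [norm_pow]
    exact pow_le_pow_left₀ (norm_nonneg _) (PiLp.norm_apply_le x i) _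

/-- The integral of a polynomial against the weight `exp (-‖x‖ ^ 2)`. -/
def gaussianIntegral (d : ℕ) [NeZero d] : MvPolynomial (Fin d) ℝ →ₗ[ℝ] ℝ where
  toFun p := ∫ x : EuclideanSpace ℝ (Fin d), eval (fun i => x i) p * Real.exp (-‖x‖ ^ 2)
  map_add' p q := by
    simp only [map_add, add_mul]
    exact integral_add (integrable_eval_mul_gaussian p) (integrable_eval_mul_gaussian q)
  map_smul' a p := by
    simp only [smul_eval, mul_assoc, RingHom.id_apply, smul_eq_mul]
    exact integral_const_mul _ _

theorem gaussianIntegral_apply {d : ℕ} [NeZero d] (p : MvPolynomial (Fin d) ℝ) :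
    gaussianIntegral d p
      = ∫ x : EuclideanSpace ℝ (Fin d), eval (fun i => x i) p * Real.exp (-‖x‖ ^ 2) := rfl

theorem gaussianIntegral_pderiv {d : ℕ} [NeZero d] (p : MvPolynomial (Fin d) ℝ) (i : Fin d) :
    gaussianIntegral d (pderiv i p) = 2 * gaussianIntegral d (X i * p) := by
  have hd : ∀ x : EuclideanSpace ℝ (Fin d), HasFDerivAt
      (fun x : EuclideanSpace ℝ (Fin d) => eval (fun i => x i) p * Real.exp (-‖x‖ ^ 2))
      (eval (fun i => x i) p • (Real.exp (-‖x‖ ^ 2) • -(2 • (innerSL ℝ x : EuclideanSpace ℝ (Fin d) →L[ℝ] ℝ))) + Real.exp (-‖x‖ ^ 2) •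
        ∑ i, eval (fun i => x i) (pderiv i p) •
        (EuclideanSpace.proj i : EuclideanSpace ℝ (Fin d) →L[ℝ] ℝ)) x := fun x =>
    (hasFDerivAt_eval_euclidean p x).mul (hasStrictFDerivAt_norm_sq x).hasFDerivAt.neg.exp
  have hv : ∀ x : EuclideanSpace ℝ (Fin d),
      (eval (fun i => x i) p • (Real.exp (-‖x‖ ^ 2) • -(2 • (innerSL ℝ x : EuclideanSpace ℝ (Fin d) →L[ℝ] ℝ))) + Real.exp (-‖x‖ ^ 2) •
        ∑ i, eval (fun i => x i) (pderiv i p) •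
          (EuclideanSpace.proj i : EuclideanSpace ℝ (Fin d) →L[ℝ] ℝ) :
          EuclideanSpace ℝ (Fin d) →L[ℝ] ℝ) (EuclideanSpace.single i 1)
      = eval (fun i => x i) (pderiv i p - C 2 * (X i * p)) * Real.exp (-‖x‖ ^ 2) := by
    intro x
    simp [EuclideanSpace.inner_single_right]
    ring
  -- Integration by parts against the constant `1` says that the integral of the `i`-th partial
  -- derivative of `p exp(-‖x‖ ^ 2)` is zero.
  have key := integral_bilinear_hasFDerivAt_right_eq_neg_left_of_integrable
    (μ := (volume : Measure (EuclideanSpace ℝ (Fin d)))) (v := EuclideanSpace.single i 1)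
    (B := ContinuousLinearMap.mul ℝ ℝ) (f := fun _ => (1 : ℝ)) (f' := fun _ => 0)
    (by simp)
    (by simpa only [hv, ContinuousLinearMap.mul_apply', one_mul] using
      integrable_eval_mul_gaussian (pderiv i p - C 2 * (X i * p)))
    (by simpa only [ContinuousLinearMap.mul_apply', one_mul] using integrable_eval_mul_gaussian p)
    (fun x _ => hasFDerivAt_const _ _) (fun x _ => hd x)
  simp only [hv, ContinuousLinearMap.mul_apply', one_mul, zero_apply, zero_mul,
    integral_zero, neg_zero] at key
  rw [← gaussianIntegral_apply, map_sub, ← smul_eq_C_mul, map_smul, smul_eq_mul] at key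
  linarith

/-- Harmonicity of `q` makes `∇p · ∇q` the divergence of `p ∇q`. Under the Gaussian integral each
`∂_i` becomes multiplication by `2 x_i`, and Euler's identity for `q` supplies the factor `m`. -/
theorem gaussianIntegral_sum_pderiv_mul {d : ℕ} [NeZero d] {m : ℕ}
    (p : MvPolynomial (Fin d) ℝ) {q : MvPolynomial (Fin d) ℝ} (hq : q ∈ solidHarmonics d m) :
    gaussianIntegral d (∑ i, pderiv i p * pderiv i q) = 2 * m * gaussianIntegral d (p * q) := by
  have hΔ : ∑ i : Fin d, pderiv i (pderiv i q) = 0 := by simpa using hq.2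
  have hE : ∑ i : Fin d, X i * pderiv i q = m • q :=
    IsHomogeneous.sum_X_mul_pderiv ((mem_homogeneousSubmodule _ _).1 hq.1)
  have h1 : ∑ i, pderiv i p * pderiv i q = ∑ i, pderiv i (p * pderiv i q) := by
    simp only [pderiv_mul, Finset.sum_add_distrib, ← Finset.mul_sum, hΔ, mul_zero, add_zero]
  have h2 : ∑ i, X i * (p * pderiv i q) = (m : ℝ) • (p * q) := by
    simp only [mul_left_comm _ p, ← Finset.mul_sum, hE]
    rw [← Nat.cast_smul_eq_nsmul ℝ, mul_smul_comm]
  rw [h1, map_sum]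
  simp only [gaussianIntegral_pderiv]
  rw [← Finset.mul_sum, ← map_sum, h2, map_smul, smul_eq_mul, mul_assoc]

/-- The integral of `∇p · ∇q` is symmetric in `p` and `q`; evaluating it from either side gives the
same integral of `p q` with factors `2m` and `2m'`. -/
theorem gaussianIntegral_mul_eq_zero {d : ℕ} [NeZero d] {m m' : ℕ} (hm : m ≠ m')
    {p q : MvPolynomial (Fin d) ℝ} (hp : p ∈ solidHarmonics d m) (hq : q ∈ solidHarmonics d m') :
    gaussianIntegral d (p * q) = 0 := by
  have h1 := gaussianIntegral_sum_pderiv_mul p hq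
  have h2 := gaussianIntegral_sum_pderiv_mul q hp
  simp only [mul_comm (pderiv _ q), mul_comm q p] at h2
  have h3 : ((m : ℝ) - m') * gaussianIntegral d (p * q) = 0 := by linarith
  exact (mul_eq_zero.1 h3).resolve_left (sub_ne_zero.2 (by exact_mod_cast hm))

/-! ### Polar coordinates and orthogonality of solid harmonics on the sphere -/

theorem eval_smul_of_isHomogeneous {σ : Type*} {p : MvPolynomial σ ℝ} {n : ℕ}
    (hp : p.IsHomogeneous n) (r : ℝ) (x : σ → ℝ) :
    eval (fun i => r * x i) p = r ^ n * eval x p := by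
  rw [eval_eq, eval_eq, Finset.mul_sum]
  refine Finset.sum_congr rfl fun u hu => ?_
  have h : u.degree = n := by
    rw [Finsupp.degree_eq_weight_one]
    exact hp (mem_support_iff.1 hu)
  simp only [mul_pow, Finset.prod_mul_distrib, Finset.prod_pow_eq_pow_sum]
  rw [← Finsupp.degree_apply, h]
  ring

theorem gaussianIntegral_of_isHomogeneous {d : ℕ} [NeZero d] {p : MvPolynomial (Fin d) ℝ} {n : ℕ}
    (hp : p.IsHomogeneous n) :
    gaussianIntegral d p = sphereIntegral d (fun ξ => eval (fun i => ξ.1 i) p) *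
      ∫ r : Set.Ioi (0 : ℝ), r.1 ^ n * Real.exp (-r.1 ^ 2) ∂(Measure.volumeIoiPow (d - 1)) := by
  set E := EuclideanSpace ℝ (Fin d)
  have h := (volume : Measure E).measurePreserving_homeomorphUnitSphereProd.integral_comp
    (Homeomorph.measurableEmbedding _)
    (fun z : Metric.sphere (0 : E) 1 × Set.Ioi (0 : ℝ) => eval (fun i => z.1.1 i) p * (z.2.1 ^ n * Real.exp (-z.2.1 ^ 2)))
  rw [integral_prod_mul (fun ξ : Metric.sphere (0 : E) 1 => eval (fun i => ξ.1 i) p)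
    (fun r : Set.Ioi (0 : ℝ) => r.1 ^ n * Real.exp (-r.1 ^ 2)), finrank_euclideanSpace_fin] at h
  have hr := integral_subtype_comap (μ := volume) (measurableSet_singleton (0 : E)).compl
    (fun x : E => eval (fun i => x i) p * Real.exp (-‖x‖ ^ 2))
  rw [restrict_compl_singleton] at hr
  rw [sphereIntegral, ← h, gaussianIntegral_apply, ← hr]
  refine integral_congr_ae (Filter.Eventually.of_forall fun x => ?_)
  simp only [homeomorphUnitSphereProd_apply_snd_coe, homeomorphUnitSphereProd_apply_fst_coe]
  rw [← mul_assoc, mul_comm (eval _ p) (‖x.1‖ ^ n), ← eval_smul_of_isHomogeneous hp]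
  have hx : ‖x.1‖ ≠ 0 := norm_ne_zero_iff.2 x.2
  congr 1
  refine congrArg (fun v => eval v p) (funext fun i => ?_)
  change x.1 i = ‖x.1‖ * (‖x.1‖⁻¹ * x.1 i)
  rw [mul_inv_cancel_left₀ hx]

/-- Being nonzero, the radial factor can be cancelled, which transfers orthogonality from the
Gaussian measure to the sphere. -/
theorem integral_volumeIoiPow_gaussian_pos (k n : ℕ) :
    0 < ∫ r : Set.Ioi (0 : ℝ), r.1 ^ n * Real.exp (-r.1 ^ 2) ∂(Measure.volumeIoiPow k) := by
  have h : ∫ r : Set.Ioi (0 : ℝ), r.1 ^ n * Real.exp (-r.1 ^ 2) ∂(Measure.volumeIoiPow k)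
      = ∫ r in Set.Ioi (0 : ℝ), r ^ ((k + n : ℕ) : ℝ) * Real.exp (-r ^ (2 : ℝ)) := by
    rw [Measure.volumeIoiPow, integral_withDensity_eq_integral_toReal_smul (by fun_prop)
      (Filter.Eventually.of_forall fun _ => ENNReal.ofReal_lt_top)]
    rw [← integral_subtype_comap measurableSet_Ioi]
    refine integral_congr_ae (Filter.Eventually.of_forall fun r => ?_)
    have hr : 0 ≤ r.1 := le_of_lt r.2
    simp only [ENNReal.toReal_ofReal (pow_nonneg hr k), Real.rpow_natCast, pow_add, smul_eq_mul,
      Real.rpow_two]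
    ring
  rw [h, integral_rpow_mul_exp_neg_rpow (by norm_num)
    (lt_of_lt_of_le (by norm_num) (Nat.cast_nonneg _))]
  have : 0 < Real.Gamma ((((k + n : ℕ) : ℝ) + 1) / 2) := Real.Gamma_pos_of_pos (by positivity)
  positivity

theorem sphereInner_eq_zero {d : ℕ} [NeZero d] {m m' : ℕ} (hm : m ≠ m')
    {p q : MvPolynomial (Fin d) ℝ} (hp : p ∈ solidHarmonics d m) (hq : q ∈ solidHarmonics d m') :
    sphereInner d p q = 0 := by
  have h := gaussianIntegral_of_isHomogeneous
    (((mem_homogeneousSubmodule _ _).1 hp.1).mul ((mem_homogeneousSubmodule _ _).1 hq.1))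
  rw [gaussianIntegral_mul_eq_zero hm hp hq] at h
  have h' := (mul_eq_zero.1 h.symm).resolve_right (integral_volumeIoiPow_gaussian_pos _ _).ne'
  simp only [map_mul] at h'
  rw [sphereInner, h', mul_zero]

/-! ### Decomposition of polynomials on the cone into solid harmonics -/

/-- The Laplacian lowers degrees by exactly two, so it acts on each homogeneous component
separately. -/
theorem homogeneousComponent_mem_solidHarmonics {d : ℕ} {p : MvPolynomial (Fin d) ℝ}
    (hp : ∑ i : Fin d, pderiv i (pderiv i p) = 0) (k : ℕ) :
    homogeneousComponent k p ∈ solidHarmonics d k := by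
  refine ⟨homogeneousComponent_mem k p, ?_⟩
  have h : ∑ i : Fin d, pderiv i (pderiv i (homogeneousComponent k p)) = 0 := by
    ext m
    have h2 : ∀ i : Fin d, coeff m (pderiv i (pderiv i (homogeneousComponent k p)))
        = if m.degree + 2 = k then coeff m (pderiv i (pderiv i p)) else 0 := by
      intro i
      simp only [coeff_pderiv, coeff_homogeneousComponent, map_add, Finsupp.degree_single]
      have h3 : m.degree + 1 + 1 = k ↔ m.degree + 2 = k := by omega
      simp only [h3]
      split_ifs <;> simp
    simp only [coeff_sum, h2, coeff_zero]
    split_ifs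
    · rw [← coeff_sum, hp, coeff_zero]
    · simp
  simpa using h

theorem homogeneousComponent_mul_of_isHomogeneous {σ : Type*} {r : MvPolynomial σ ℝ} {j : ℕ}
    (hr : r.IsHomogeneous j) (g : MvPolynomial σ ℝ) (k : ℕ) :
    homogeneousComponent k (r * g) = if j ≤ k then r * homogeneousComponent (k - j) g else 0 := by
  induction g using MvPolynomial.induction_on' with
  | monomial u a =>
    have hu := isHomogeneous_monomial a (rfl : u.degree = u.degree)
    rw [homogeneousComponent_of_mem ((mem_homogeneousSubmodule _ _).2 (hr.mul hu)),
      homogeneousComponent_of_mem ((mem_homogeneousSubmodule _ _).2 hu)]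
    split_ifs <;> first | rfl | omega | simp
  | add p q hp hq =>
    rw [mul_add, map_add, hp, hq, map_add]
    split_ifs <;> ring

/-- A homogeneous polynomial is the sum of a solid harmonic and a multiple of `‖x‖ ^ 2`. -/
theorem exists_solidHarmonic_add_normSq_mul {d : ℕ} [NeZero d] {k : ℕ}
    {p : MvPolynomial (Fin d) ℝ} (hp : p.IsHomogeneous k) :
    ∃ Y ∈ solidHarmonics d k, p = Y ∨
      2 ≤ k ∧ ∃ q : MvPolynomial (Fin d) ℝ, q.IsHomogeneous (k - 2) ∧
        p = Y + (∑ i, X i ^ 2) * q := by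
  -- Take the representative `F` of `p` harmonic in `x` and set `t = 0` (the map `φ` below). This
  -- commutes with the `x`-derivatives and sends the quadric to `-‖x‖ ^ 2`, so `F(x, 0)` is harmonic
  -- and differs from `p` by a multiple of `‖x‖ ^ 2`. The components of degree `k` give the claim.
  obtain ⟨⟨F, hF⟩, hFp⟩ := (bijective_toCone_xHarmonic d).2 (toCone d (rename Fin.castSucc p))
  have hmem : F - rename Fin.castSucc p ∈ coneIdeal d := Ideal.Quotient.eq.1 hFp
  obtain ⟨g, hg⟩ := Ideal.mem_span_singleton'.1 hmem
  let φ : Ambient d →ₐ[ℝ] MvPolynomial (Fin d) ℝ :=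
    aeval (Fin.snoc (fun i : Fin d => X i) 0 : Fin (d + 1) → MvPolynomial (Fin d) ℝ)
  have hφX : ∀ i : Fin d, φ (X i.castSucc) = X i := fun i => by simp [φ]
  have hφl : φ (X (Fin.last d)) = 0 := by simp [φ]
  have hφp : φ (rename Fin.castSucc p) = p := by
    have : (φ.comp (rename Fin.castSucc)) = AlgHom.id ℝ _ := by
      ext i : 1
      simp [hφX]
    exact congrArg (fun f => f p) this
  have hφd : ∀ (i : Fin d) (f : Ambient d), φ (pderiv i.castSucc f) = pderiv i (φ f) := by
    intro i f
    induction f using MvPolynomial.induction_on with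
    | C a => simp [φ]
    | add p q hp hq => simp only [map_add, hp, hq]
    | mul_X f j hf =>
      rw [pderiv_mul, map_add, map_mul, map_mul, map_mul, pderiv_mul, hf]
      congr 2
      induction j using Fin.lastCases with
      | last => rw [hφl, pderiv_X_of_ne (Fin.castSucc_lt_last i).ne', map_zero, map_zero]
      | cast j =>
        rw [hφX]
        by_cases hij : j = i
        · subst hij; simp
        · rw [pderiv_X_of_ne hij, pderiv_X_of_ne fun h =>
            hij (Fin.castSucc_injective d h), map_zero]
  have hφq : φ (quadric d) = -∑ i, X i ^ 2 := by
    simp [quadric, hφX, hφl]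
  have hφF : φ F = p + (∑ i, X i ^ 2) * -φ g := by
    have h := congrArg φ hg
    rw [map_mul, map_sub, hφp, hφq] at h
    linear_combination -h
  have hΔ : ∑ i : Fin d, pderiv i (pderiv i (φ F)) = 0 := by
    have h : laplaceX d F = 0 := hF
    have h' := congrArg φ h
    rw [laplaceX_apply, map_sum, map_zero] at h'
    simpa only [hφd] using h'
  have hN : (∑ i : Fin d, X i ^ 2 : MvPolynomial (Fin d) ℝ).IsHomogeneous 2 :=
    IsHomogeneous.sum _ _ _ fun i _ => by simpa using (isHomogeneous_X ℝ i).pow 2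
  have hY := homogeneousComponent_mem_solidHarmonics hΔ k
  refine ⟨_, hY, ?_⟩
  rw [hφF, map_add, homogeneousComponent_eq_self hp, homogeneousComponent_mul_of_isHomogeneous hN]
  split_ifs with hk
  · refine Or.inr ⟨hk, homogeneousComponent (k - 2) (φ g),
      homogeneousComponent_isHomogeneous _ _, ?_⟩
    rw [map_neg]
    ring
  · exact Or.inl (by rw [add_zero])

theorem toCone_rename_normSq (d : ℕ) :
    toCone d (rename Fin.castSucc (∑ i : Fin d, X i ^ 2)) = toCone d (X (Fin.last d) ^ 2) := by
  refine Ideal.Quotient.eq.2 ?_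
  rw [← neg_mem_iff, neg_sub]
  refine Ideal.subset_span ?_
  simp [quadric]

/-- Strong induction on the degree in `x`: on the cone the factor `‖x‖ ^ 2` is traded for `t ^ 2`,
which lowers that degree by two and leaves `b + k` unchanged. -/
theorem toCone_X_pow_mul_rename_mem {d : ℕ} [NeZero d] {n : ℕ} {T : Submodule ℝ (ConeRing d)}
    (hT : ∀ (b m : ℕ) (Y : MvPolynomial (Fin d) ℝ), Y ∈ solidHarmonics d m → b + m ≤ n →
      toCone d (X (Fin.last d) ^ b * rename Fin.castSucc Y) ∈ T)
    (k b : ℕ) (p : MvPolynomial (Fin d) ℝ) (hp : p.IsHomogeneous k) (hkb : b + k ≤ n) :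
    toCone d (X (Fin.last d) ^ b * rename Fin.castSucc p) ∈ T := by
  induction k using Nat.strong_induction_on generalizing b p with
  | _ k ih =>
    obtain ⟨Y, hY, rfl | ⟨hk, q, hq, rfl⟩⟩ := exists_solidHarmonic_add_normSq_mul hp
    · exact hT b k _ hY hkb
    · have h1 := hT b k _ hY hkb
      have h2 := ih (k - 2) (by omega) (b + 2) q hq (by omega)
      have h3 : toCone d (X (Fin.last d) ^ b * rename Fin.castSucc (Y + (∑ i, X i ^ 2) * q))
          = toCone d (X (Fin.last d) ^ b * rename Fin.castSucc Y)
            + toCone d (X (Fin.last d) ^ (b + 2) * rename Fin.castSucc q) := by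
        rw [map_add (rename _), map_mul (rename _), mul_add, map_add (toCone d),
          map_mul (toCone d) _ (_ * _), map_mul (toCone d) (rename _ _), toCone_rename_normSq,
          ← map_mul, ← map_mul]
        congr 2
        ring
      rw [h3]
      exact T.add_mem h1 h2

theorem monomial_eq_X_last_pow_mul_rename {d : ℕ} (u : Fin (d + 1) →₀ ℕ) (a : ℝ) :
    (monomial u a : Ambient d) = X (Fin.last d) ^ u (Fin.last d) *
      rename Fin.castSucc (C a * ∏ i : Fin d, X i ^ u i.castSucc) := by
  rw [monomial_eq, Finsupp.prod_fintype _ _ (by simp), Fin.prod_univ_castSucc]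
  simp only [map_mul, map_prod, map_pow, rename_X, rename_C]
  ring

/-- The polynomials of degree at most `n` on the cone are spanned by the products `t ^ b Y(x)` of
degree at most `n`, with solid harmonics `Y`. -/
theorem conePolys_le {d : ℕ} [NeZero d] {n : ℕ} {T : Submodule ℝ (ConeRing d)}
    (hT : ∀ (b m : ℕ) (Y : MvPolynomial (Fin d) ℝ), Y ∈ solidHarmonics d m → b + m ≤ n →
      toCone d (X (Fin.last d) ^ b * rename Fin.castSucc Y) ∈ T) :
    conePolys d n ≤ T := by
  rintro _ ⟨p, hp, rfl⟩
  have hp' : p.totalDegree ≤ n := (mem_restrictTotalDegree _ _ _).1 hp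
  rw [AlgHom.toLinearMap_apply, p.as_sum, map_sum]
  refine T.sum_mem fun u hu => ?_
  rw [monomial_eq_X_last_pow_mul_rename]
  refine toCone_X_pow_mul_rename_mem hT (∑ i : Fin d, u i.castSucc) _ _ ?_ ?_
  · have h := (isHomogeneous_C (Fin d) (coeff u p)).mul
      (IsHomogeneous.prod Finset.univ (fun i : Fin d => (X i : MvPolynomial (Fin d) ℝ)
        ^ u i.castSucc) (fun i => u i.castSucc) fun i _ => by
          simpa using (isHomogeneous_X ℝ i).pow (u i.castSucc))
    simpa using h
  · have h : u.degree ≤ n := (le_totalDegree hu).trans hp'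
    rw [Finsupp.degree_eq_sum, Fin.sum_univ_castSucc] at h
    omega

/-! ### Alternating binomial sums and Pochhammer symbols -/

theorem poch_pos {a : ℝ} (ha : 0 < a) (n : ℕ) : 0 < poch a n := ascPochhammer_pos n a ha

theorem poch_zero (a : ℝ) : poch a 0 = 1 := by simp [poch]

theorem poch_succ (a : ℝ) (n : ℕ) : poch a (n + 1) = poch a n * (a + n) :=
  ascPochhammer_succ_eval n a

theorem poch_add (a : ℝ) (n m : ℕ) : poch a (n + m) = poch a n * poch (a + n) m := by
  simp [poch, ← ascPochhammer_mul]

theorem poch_neg_natCast (n k : ℕ) :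
    poch (-(n : ℝ)) k = (-1) ^ k * (k.factorial * n.choose k) := by
  rw [poch, ascPochhammer_eval_neg_eq_descPochhammer, descPochhammer_eval_eq_descFactorial,
    Nat.descFactorial_eq_factorial_mul_choose, Nat.cast_mul]

theorem sum_neg_one_pow_mul_choose_mul (f : ℝ → ℝ) (n : ℕ) (y : ℝ) :
    ∑ k ∈ Finset.range (n + 1), (-1) ^ k * (n.choose k : ℝ) * f (y + k)
      = (-1) ^ n * (fwdDiff 1)^[n] f y := by
  rw [fwdDiff_iter_eq_sum_shift, Finset.mul_sum]
  refine Finset.sum_congr rfl fun k hk => ?_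
  have h : ((-1 : ℝ) ^ n * (-1) ^ (n - k)) = (-1) ^ k := by
    obtain ⟨j, rfl⟩ := Nat.exists_eq_add_of_le (Nat.lt_succ_iff.1 (Finset.mem_range.1 hk))
    rw [Nat.add_sub_cancel_left, pow_add, mul_assoc, ← mul_pow]
    simp
  rw [← h]
  simp
  ring

/-- The sum is, up to sign, an `n`-th forward difference, which annihilates polynomials of degree
below `n`. -/
theorem sum_neg_one_pow_mul_choose_mul_eval {P : Polynomial ℝ} {n : ℕ} (hP : P.natDegree < n)
    (y : ℝ) :
    ∑ k ∈ Finset.range (n + 1), (-1) ^ k * (n.choose k : ℝ) * P.eval (y + k) = 0 := by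
  rw [sum_neg_one_pow_mul_choose_mul (fun y => P.eval y),
    Polynomial.fwdDiff_iter_eq_zero_of_degree_lt hP]
  simp

theorem iterate_fwdDiff_inv (n : ℕ) (y : ℝ) (hy : 0 < y) :
    (fwdDiff 1)^[n] (fun y : ℝ => y⁻¹) y = (-1) ^ n * n.factorial / poch y (n + 1) := by
  induction n generalizing y with
  | zero => simp [poch_succ, poch_zero]
  | succ n ih =>
    rw [Function.iterate_succ_apply', fwdDiff, ih y hy, ih (y + 1) (by positivity)]
    have h1 : poch y (n + 1 + 1) = y * poch (y + 1) (n + 1) := by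
      rw [add_comm, poch_add, Nat.cast_one, poch_succ, poch_zero]
      simp
    have h2 : poch y (n + 1 + 1) = poch y (n + 1) * (y + (n + 1 : ℕ)) := poch_succ y (n + 1)
    have p1 := poch_pos hy (n + 1)
    have p2 := poch_pos (show 0 < y + 1 by positivity) (n + 1)
    have p3 := poch_pos hy (n + 1 + 1)
    have e1 : (poch (y + 1) (n + 1))⁻¹ = y / poch y (n + 1 + 1) := by
      rw [h1]; field_simp
    have e2 : (poch y (n + 1))⁻¹ = (y + (n + 1 : ℕ)) / poch y (n + 1 + 1) := by
      rw [h2]; field_simp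
    rw [div_eq_mul_inv, div_eq_mul_inv, e1, e2, Nat.factorial_succ]
    push_cast
    ring

theorem sum_neg_one_pow_mul_choose_div (n : ℕ) (x : ℝ) (hx : 0 < x) :
    ∑ k ∈ Finset.range (n + 1), (-1) ^ k * (n.choose k : ℝ) * (x + k)⁻¹
      = n.factorial / poch x (n + 1) := by
  rw [sum_neg_one_pow_mul_choose_mul (fun y => y⁻¹), iterate_fwdDiff_inv n x hx, ← mul_div_assoc,
    ← mul_assoc, ← mul_pow]
  simp

/-- Partial fractions for the quotient of two Pochhammer symbols. -/
theorem sum_neg_one_pow_mul_choose_mul_poch_div (n : ℕ) (b x : ℝ) (hx : 0 < x) :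
    ∑ k ∈ Finset.range (n + 1), (-1) ^ k * (n.choose k : ℝ) * poch (b + k) n * (x + k)⁻¹
      = n.factorial * poch (b - x) n / poch x (n + 1) := by
  -- At `y = b + k` the divisor `y - (b - x)` equals `x + k` and cancels the denominator. The
  -- quotient then contributes an `n`-th difference of a polynomial of degree below `n`, and only
  -- the constant remainder over `x + k` survives.
  set q : Polynomial ℝ := ascPochhammer ℝ n /ₘ (Polynomial.X - Polynomial.C (b - x)) with hq
  have hdiv : ∀ y, poch y n = poch (b - x) n + (y - (b - x)) * q.eval y := by
    intro y
    have h := Polynomial.modByMonic_add_div (ascPochhammer ℝ n)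
      (Polynomial.X - Polynomial.C (b - x))
    rw [Polynomial.modByMonic_X_sub_C_eq_C_eval] at h
    have h' := congrArg (Polynomial.eval y) h
    simp only [Polynomial.eval_add, Polynomial.eval_mul, Polynomial.eval_sub, Polynomial.eval_X,
      Polynomial.eval_C] at h'
    exact h'.symm
  have hq0 : ∑ k ∈ Finset.range (n + 1), (-1) ^ k * (n.choose k : ℝ) * q.eval (b + k) = 0 := by
    -- For `n = 0` no degree is below `n`, but then the quotient itself is zero.
    rcases Nat.eq_zero_or_pos n with rfl | hn
    · have : q = 0 := by
        rw [hq, Polynomial.divByMonic_eq_zero_iff (Polynomial.monic_X_sub_C _),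
          Polynomial.degree_X_sub_C]
        simp
      simp [this]
    · refine sum_neg_one_pow_mul_choose_mul_eval ?_ b
      rw [hq, Polynomial.natDegree_divByMonic _ (Polynomial.monic_X_sub_C _),
        ascPochhammer_natDegree, Polynomial.natDegree_X_sub_C]
      omega
  have hterm : ∀ k ∈ Finset.range (n + 1),
      (-1) ^ k * (n.choose k : ℝ) * poch (b + k) n * (x + k)⁻¹
        = poch (b - x) n * ((-1) ^ k * (n.choose k : ℝ) * (x + k)⁻¹)
          + (-1) ^ k * (n.choose k : ℝ) * q.eval (b + k) := by
    intro k _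
    have hk : x + k ≠ 0 := by positivity
    rw [hdiv (b + k)]
    field_simp
    ring
  rw [Finset.sum_congr rfl hterm, Finset.sum_add_distrib, ← Finset.mul_sum, hq0,
    sum_neg_one_pow_mul_choose_div n x hx]
  ring

/-! ### Jacobi polynomials on the unit interval -/

/-- The coefficients of `P_n^{(α,0)}(1 - 2 t)`. -/
def shiftedCoeff (α : ℝ) (n k : ℕ) : ℝ :=
  (-1) ^ k * (n.choose k : ℝ) * poch (α + 1 + k) n / n.factorial

/-- The polynomial `P_n^{(α,0)}(1 - 2 t)`. -/
def shiftedJacobi (α : ℝ) (n : ℕ) : Polynomial ℝ :=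
  ∑ k ∈ Finset.range (n + 1), Polynomial.monomial k (shiftedCoeff α n k)

/-- The hypergeometric variable `(1 - u) / 2` at `u = 1 - 2t` is `t`. The coefficients match because
`(α+1)_n (α+1+n)_k` and `(α+1)_k (α+1+k)_n` both equal `(α+1)_{n+k}`. -/
theorem jacobi_comp {α : ℝ} (hα : -1 < α) (n : ℕ) :
    (jacobi α 0 n).comp (1 - 2 * Polynomial.X) = shiftedJacobi α n := by
  rw [jacobi, shiftedJacobi, Polynomial.mul_comp, Polynomial.C_comp, Polynomial.sum_comp,
    Finset.mul_sum]
  refine Finset.sum_congr rfl fun k _ => ?_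
  have hX : (Polynomial.C (1 / 2 : ℝ) * (1 - Polynomial.X)).comp (1 - 2 * Polynomial.X)
      = Polynomial.X := by
    have : Polynomial.C (1 / 2 : ℝ) * 2 = 1 := by
      rw [← map_ofNat Polynomial.C 2, ← map_mul]
      norm_num
    simp only [Polynomial.mul_comp, Polynomial.sub_comp, Polynomial.C_comp, Polynomial.one_comp,
      Polynomial.X_comp, sub_sub_cancel, ← mul_assoc, this, one_mul]
  rw [Polynomial.mul_comp, Polynomial.C_comp, Polynomial.pow_comp, hX, ← mul_assoc, ← map_mul,
    Polynomial.C_mul_X_pow_eq_monomial]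
  congr 1
  have h1 : poch (α + 1) n * poch (n + α + 0 + 1) k = poch (α + 1) k * poch (α + 1 + k) n := by
    rw [← poch_add, add_comm k n, poch_add]
    congr 2
    ring
  have h2 := (poch_pos (show 0 < α + 1 by linarith) k).ne'
  have h3 : (k.factorial : ℝ) ≠ 0 := by positivity
  have h4 : (n.factorial : ℝ) ≠ 0 := by positivity
  rw [shiftedCoeff, poch_neg_natCast]
  field_simp
  linear_combination (n.choose k : ℝ) * h1

theorem coeff_shiftedJacobi (α : ℝ) (n k : ℕ) :
    (shiftedJacobi α n).coeff k = shiftedCoeff α n k := by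
  simp only [shiftedJacobi, Polynomial.finsetSum_coeff, Polynomial.coeff_monomial,
    Finset.sum_ite_eq', Finset.mem_range]
  split_ifs with h
  · rfl
  · rw [shiftedCoeff, Nat.choose_eq_zero_of_lt (by omega)]
    simp

theorem natDegree_shiftedJacobi_le (α : ℝ) (n : ℕ) : (shiftedJacobi α n).natDegree ≤ n :=
  Polynomial.natDegree_sum_le_of_forall_le _ _ fun _ hk =>
    (Polynomial.natDegree_monomial_le _).trans (Nat.lt_succ_iff.1 (Finset.mem_range.1 hk))

theorem coeff_shiftedJacobi_ne_zero {α : ℝ} (hα : -1 < α) (n : ℕ) :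
    (shiftedJacobi α n).coeff n ≠ 0 := by
  rw [coeff_shiftedJacobi, shiftedCoeff, Nat.choose_self]
  have := (poch_pos (show 0 < α + 1 + n by have : (0 : ℝ) ≤ n := Nat.cast_nonneg n; linarith) n).ne'
  positivity

/-- The linear functional `p ↦ ∫ t ^ α p(t) dt` over `[0, 1]`. -/
def powerMoment (α : ℝ) : Polynomial ℝ →ₗ[ℝ] ℝ :=
  Polynomial.lsum fun k => (α + k + 1)⁻¹ • LinearMap.id

theorem powerMoment_monomial (α : ℝ) (k : ℕ) (a : ℝ) :
    powerMoment α (Polynomial.monomial k a) = a * (α + k + 1)⁻¹ := by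
  rw [powerMoment, Polynomial.lsum_apply, Polynomial.sum_monomial_index _ _ (by simp)]
  simp [mul_comm]

theorem intervalIntegrable_rpow_mul_eval {α : ℝ} (hα : -1 < α) (p : Polynomial ℝ) :
    IntervalIntegrable (fun t : ℝ => t ^ α * p.eval t) volume 0 1 :=
  (intervalIntegral.intervalIntegrable_rpow' hα).mul_continuousOn p.continuous.continuousOn

theorem integral_rpow_mul_eval {α : ℝ} (hα : -1 < α) (p : Polynomial ℝ) :
    ∫ t in (0 : ℝ)..1, t ^ α * p.eval t = powerMoment α p := by
  induction p using Polynomial.induction_on' with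
  | add p q hp hq =>
    simp only [Polynomial.eval_add, mul_add]
    rw [intervalIntegral.integral_add (intervalIntegrable_rpow_mul_eval hα p)
      (intervalIntegrable_rpow_mul_eval hα q), hp, hq, map_add]
  | monomial k a =>
    have hk : (0 : ℝ) ≤ k := Nat.cast_nonneg k
    have h : ∫ t in (0 : ℝ)..1, t ^ α * (Polynomial.monomial k a).eval t
        = ∫ t in (0 : ℝ)..1, a * t ^ (α + k) := by
      refine intervalIntegral.integral_congr_ae (Filter.Eventually.of_forall fun t ht => ?_)
      rw [Set.uIoc_of_le zero_le_one] at ht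
      rw [Polynomial.eval_monomial, Real.rpow_add ht.1, Real.rpow_natCast]
      ring
    rw [h, intervalIntegral.integral_const_mul, integral_rpow (Or.inl (by linarith)),
      powerMoment_monomial, Real.one_rpow, Real.zero_rpow (by linarith)]
    ring

/-- This is the partial fraction identity with `b = α + 1` and `x = α + 1 + j`. The numerator
`(-j)_n` vanishes for `j < n`, which is the orthogonality to lower powers. -/
theorem powerMoment_shiftedJacobi_mul_X_pow {α : ℝ} (hα : -1 < α) (n j : ℕ) :
    powerMoment α (shiftedJacobi α n * Polynomial.X ^ j)
      = poch (-(j : ℝ)) n / poch (α + 1 + j) (n + 1) := by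
  have hx : 0 < α + 1 + j := by
    have : (0 : ℝ) ≤ j := Nat.cast_nonneg j
    linarith
  rw [shiftedJacobi, Finset.sum_mul, map_sum]
  have h := sum_neg_one_pow_mul_choose_mul_poch_div n (α + 1) (α + 1 + j) hx
  rw [sub_add_cancel_left] at h
  have hn : (n.factorial : ℝ) ≠ 0 := by positivity
  have h' : poch (-(j : ℝ)) n / poch (α + 1 + j) (n + 1)
      = (n.factorial : ℝ)⁻¹ * (n.factorial * poch (-(j : ℝ)) n / poch (α + 1 + j) (n + 1)) := by
    field_simp
  rw [h', ← h, Finset.mul_sum]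
  refine Finset.sum_congr rfl fun k _ => ?_
  rw [Polynomial.monomial_mul_X_pow, powerMoment_monomial, shiftedCoeff]
  push_cast
  ring

theorem powerMoment_shiftedJacobi_mul {α : ℝ} (hα : -1 < α) (n : ℕ) {p : Polynomial ℝ}
    (hp : p.natDegree ≤ n) :
    powerMoment α (shiftedJacobi α n * p)
      = p.coeff n * ((-1) ^ n * n.factorial / poch (α + 1 + n) (n + 1)) := by
  conv_lhs => rw [p.as_sum_range' (n + 1) (Nat.lt_succ_of_le hp)]
  rw [Finset.mul_sum, map_sum, Finset.sum_range_succ, Finset.sum_eq_zero, zero_add]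
  · rw [← Polynomial.C_mul_X_pow_eq_monomial, mul_left_comm, ← Polynomial.smul_eq_C_mul, map_smul,
      powerMoment_shiftedJacobi_mul_X_pow hα, poch_neg_natCast, Nat.choose_self, smul_eq_mul]
    simp
  · intro j hj
    rw [← Polynomial.C_mul_X_pow_eq_monomial, mul_left_comm, ← Polynomial.smul_eq_C_mul, map_smul,
      powerMoment_shiftedJacobi_mul_X_pow hα, poch_neg_natCast,
      Nat.choose_eq_zero_of_lt (Finset.mem_range.1 hj)]
    simp

theorem powerMoment_shiftedJacobi_mul_of_ne {α : ℝ} (hα : -1 < α) {n m : ℕ} (h : n ≠ m) :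
    powerMoment α (shiftedJacobi α n * shiftedJacobi α m) = 0 := by
  have key : ∀ i j : ℕ, i < j →
      powerMoment α (shiftedJacobi α j * shiftedJacobi α i) = 0 := fun i j hij => by
    have hd := natDegree_shiftedJacobi_le α i
    rw [powerMoment_shiftedJacobi_mul hα j (hd.trans hij.le),
      Polynomial.coeff_eq_zero_of_natDegree_lt (lt_of_le_of_lt hd hij), zero_mul]
  rcases lt_or_gt_of_ne h with h | h
  · rw [mul_comm]; exact key n m h
  · exact key m n h

theorem powerMoment_shiftedJacobi_sq {α : ℝ} (hα : -1 < α) (n : ℕ) :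
    powerMoment α (shiftedJacobi α n * shiftedJacobi α n) = (α + 2 * n + 1)⁻¹ := by
  have hn : (0 : ℝ) ≤ n := Nat.cast_nonneg n
  rw [powerMoment_shiftedJacobi_mul hα n (natDegree_shiftedJacobi_le α n), coeff_shiftedJacobi,
    shiftedCoeff, Nat.choose_self, poch_succ]
  have h1 := (poch_pos (show 0 < α + 1 + n by linarith) n).ne'
  have h3 : α + 2 * n + 1 ≠ 0 := by linarith
  have h4 : (n.factorial : ℝ) ≠ 0 := by positivity
  have h5 : ((-1 : ℝ) ^ n) * (-1) ^ n = 1 := by rw [← mul_pow]; simp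
  rw [show α + 1 + n + n = α + 2 * n + 1 by ring]
  generalize α + 2 * (n : ℝ) + 1 = D at *
  field_simp
  linear_combination h5

theorem jacobiA_pos {α : ℝ} (hα : -1 < α) (n : ℕ) : 0 < jacobiA α 0 n := by
  rcases Nat.eq_zero_or_pos n with rfl | hn
  · simp [jacobiA, poch_zero]
  · have hn' : (1 : ℝ) ≤ n := by exact_mod_cast hn
    have := poch_pos (show 0 < n + α + 0 + 1 by linarith) n
    rw [jacobiA]
    positivity

/-- For second parameter `0` the factor `(1)_n` cancels `n!`, and `(α+1)_n (α+n+1) = (α+1) (α+2)_n`.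
The closed form also covers the separate convention at `n = 0`. -/
theorem jacobiH_zero_right {α : ℝ} (hα : -1 < α) (n : ℕ) :
    jacobiH α 0 n = (α + 1) / (α + 2 * n + 1) := by
  have hn : (0 : ℝ) ≤ n := Nat.cast_nonneg n
  rw [jacobiH]
  split_ifs with h
  · subst h
    have : α + 1 ≠ 0 := by linarith
    simp [this]
  · have h1 : poch (α + 1) n * (α + n + 1) = (α + 1) * poch (α + 2) n := by
      have e1 := poch_succ (α + 1) n
      have e2 := poch_add (α + 1) 1 n
      rw [add_comm 1 n, e1] at e2
      have e3 : poch (α + 1) 1 = α + 1 := by simp [poch]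
      rw [e3, Nat.cast_one, show α + 1 + 1 = α + 2 by ring] at e2
      rw [← e2]
      ring
    have h2 : poch (0 + 1) n = n.factorial := by
      rw [poch, zero_add, ascPochhammer_eval_one]
    have h3 : (n.factorial : ℝ) ≠ 0 := by positivity
    have h4 := (poch_pos (show 0 < α + 2 by linarith) n).ne'
    have h5 : α + 2 * n + 1 ≠ 0 := by linarith
    rw [h2]
    simp only [add_zero]
    generalize α + 2 * (n : ℝ) + 1 = D at *
    field_simp
    linear_combination h1

theorem jacobiHatH_zero_right {α : ℝ} (hα : -1 < α) (n : ℕ) :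
    jacobiHatH α 0 n = 2 ^ (α + 1) * jacobiA α 0 n ^ 2 * (α + 2 * n + 1)⁻¹ := by
  have h1 : jacobiC α 0 = α + 1 := by
    have h : Real.Gamma (α + 1) ≠ 0 := (Real.Gamma_pos_of_pos (by linarith)).ne'
    rw [jacobiC, add_zero, zero_add, Real.Gamma_one, show α + 2 = α + 1 + 1 by ring,
      Real.Gamma_add_one (by linarith)]
    field_simp
  have h2 : α + 1 ≠ 0 := by linarith
  rw [jacobiHatH, h1, jacobiH_zero_right hα, add_zero]
  field_simp

/-! ### The Sobolev polynomials in one variable -/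

/-- The polynomial `J_j^{(α-s,-s)}(1 - 2 t)`. -/
def sobolevProfile (α : ℝ) (s j : ℕ) : Polynomial ℝ :=
  (sobolevJacobi α 0 s j).comp (1 - 2 * Polynomial.X)

/-- The Sobolev form in one variable for the weight `t ^ α` on `[0, 1]`. -/
def intervalForm (α : ℝ) (s : ℕ) (lam : ℕ → ℝ) (p q : Polynomial ℝ) : ℝ :=
  powerMoment α (Polynomial.derivative^[s] p * Polynomial.derivative^[s] q)
    + ∑ k ∈ Finset.range s, lam k *
      ((Polynomial.derivative^[k] p).eval 1 * (Polynomial.derivative^[k] q).eval 1)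

theorem iterate_derivative_comp_one_sub_two_mul_X (p : Polynomial ℝ) (k : ℕ) :
    Polynomial.derivative^[k] (p.comp (1 - 2 * Polynomial.X))
      = Polynomial.C ((-2) ^ k) * (Polynomial.derivative^[k] p).comp (1 - 2 * Polynomial.X) := by
  have h : Polynomial.derivative (1 - 2 * Polynomial.X : Polynomial ℝ) = Polynomial.C (-2) := by
    rw [← map_ofNat Polynomial.C 2, Polynomial.derivative_sub, Polynomial.derivative_one,
      Polynomial.derivative_C_mul_X, map_neg, zero_sub]
  induction k with
  | zero => simp
  | succ k ih =>
    rw [Function.iterate_succ_apply', ih, Polynomial.derivative_C_mul, Polynomial.derivative_comp,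
      h, Function.iterate_succ_apply', pow_succ, map_mul]
    ring

theorem iterate_derivative_iterate_antideriv (k r : ℕ) (p : Polynomial ℝ) :
    Polynomial.derivative^[k] (antideriv^[k + r] p) = antideriv^[r] p := by
  induction k with
  | zero => simp
  | succ k ih =>
    rw [Function.iterate_succ_apply, show k + 1 + r = (k + r) + 1 by ring,
      Function.iterate_succ_apply' antideriv, derivative_antideriv, ih]

theorem natDegree_antideriv_le (p : Polynomial ℝ) : (antideriv p).natDegree ≤ p.natDegree + 1 := by
  rw [antideriv]
  refine (Polynomial.natDegree_sub_le _ _).trans (max_le ?_ (by simp))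
  exact Polynomial.natDegree_sum_le_of_forall_le _ _ fun k hk =>
    (Polynomial.natDegree_monomial_le _).trans
      (Nat.succ_le_succ (Polynomial.le_natDegree_of_mem_supp k hk))

theorem natDegree_iterate_antideriv_le (s : ℕ) (p : Polynomial ℝ) :
    (antideriv^[s] p).natDegree ≤ p.natDegree + s := by
  induction s with
  | zero => simp
  | succ s ih =>
    rw [Function.iterate_succ_apply']
    exact (natDegree_antideriv_le _).trans (by omega)

theorem natDegree_jacobiHat_le (α γ : ℝ) (n : ℕ) : (jacobiHat α γ n).natDegree ≤ n := by
  have h1 : (Polynomial.C (1 / 2 : ℝ) * (1 - Polynomial.X)).natDegree ≤ 1 := by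
    compute_degree
  refine (Polynomial.natDegree_C_mul_le _ _).trans ((Polynomial.natDegree_C_mul_le _ _).trans ?_)
  refine Polynomial.natDegree_sum_le_of_forall_le _ _ fun k hk => ?_
  refine (Polynomial.natDegree_C_mul_le _ _).trans (Polynomial.natDegree_pow_le.trans ?_)
  exact (Nat.mul_le_mul_left k h1).trans
    (by rw [mul_one]; exact Nat.lt_succ_iff.1 (Finset.mem_range.1 hk))

theorem natDegree_sobolevJacobi_le (α γ : ℝ) (s j : ℕ) :
    (sobolevJacobi α γ s j).natDegree ≤ j := by
  rw [sobolevJacobi]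
  split_ifs with h
  · refine (Polynomial.natDegree_C_mul_le _ _).trans (Polynomial.natDegree_pow_le.trans ?_)
    have : (Polynomial.X + 1 : Polynomial ℝ).natDegree ≤ 1 := by compute_degree
    simpa using Nat.mul_le_mul_left j this
  · have h1 := natDegree_iterate_antideriv_le s (jacobiHat α γ (j - s))
    have h2 := natDegree_jacobiHat_le α γ (j - s)
    omega

theorem natDegree_sobolevProfile_le (α : ℝ) (s j : ℕ) : (sobolevProfile α s j).natDegree ≤ j := by
  have h : (1 - 2 * Polynomial.X : Polynomial ℝ).natDegree ≤ 1 := by compute_degree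
  refine Polynomial.natDegree_comp_le.trans ?_
  simpa using Nat.mul_le_mul (natDegree_sobolevJacobi_le α 0 s j) h

theorem iterate_derivative_X_add_one_pow_div_factorial (j k : ℕ) :
    Polynomial.derivative^[k] (Polynomial.C (1 / (j.factorial : ℝ)) * (Polynomial.X + 1) ^ j)
      = Polynomial.C (j.descFactorial k / (j.factorial : ℝ)) * (Polynomial.X + 1) ^ (j - k) := by
  have h := Polynomial.iterate_derivative_X_add_pow j k (1 : ℝ)
  rw [map_one] at h
  rw [Polynomial.iterate_derivative_C_mul, h, nsmul_eq_mul, ← mul_assoc,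
    ← map_natCast Polynomial.C, ← map_mul]
  congr 2
  ring

/-- For `j < s` the degree is too small; for `j ≥ s` the derivatives undo the `s` antiderivatives.
The factor `(-2) ^ s` is the chain rule for `1 - 2t`. -/
theorem iterate_derivative_sobolevProfile {α : ℝ} (hα : -1 < α) (s j : ℕ) :
    Polynomial.derivative^[s] (sobolevProfile α s j) = if j < s then 0 else
      Polynomial.C ((-2) ^ s * jacobiA α 0 (j - s)) * shiftedJacobi α (j - s) := by
  rw [sobolevProfile, iterate_derivative_comp_one_sub_two_mul_X, sobolevJacobi]
  split_ifs with h
  · rw [iterate_derivative_X_add_one_pow_div_factorial, Nat.descFactorial_of_lt h]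
    simp
  · have h1 := iterate_derivative_iterate_antideriv s 0 (jacobiHat α 0 (j - s))
    rw [add_zero] at h1
    rw [h1, Function.iterate_zero_apply, jacobiHat, Polynomial.mul_comp, Polynomial.C_comp,
      jacobi_comp hα, map_mul, mul_assoc]

/-- The point `t = 1` corresponds to the argument `-1`, where positive powers of `u + 1` and all
antiderivatives vanish. -/
theorem eval_iterate_derivative_sobolevProfile (α : ℝ) {s k : ℕ} (hk : k < s) (j : ℕ) :
    (Polynomial.derivative^[k] (sobolevProfile α s j)).eval 1
      = if j = k then (-2) ^ k else 0 := by
  have h1 : Polynomial.eval (1 : ℝ) (1 - 2 * Polynomial.X : Polynomial ℝ) = -1 := by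
    simp; norm_num
  rw [sobolevProfile, iterate_derivative_comp_one_sub_two_mul_X, Polynomial.eval_mul,
    Polynomial.eval_C, Polynomial.eval_comp, h1, sobolevJacobi]
  split_ifs with h h2 h2
  · subst h2
    rw [iterate_derivative_X_add_one_pow_div_factorial, Nat.descFactorial_self,
      div_self (by positivity)]
    simp
  · rw [iterate_derivative_X_add_one_pow_div_factorial]
    rcases lt_or_gt_of_ne h2 with h3 | h3
    · rw [Nat.descFactorial_of_lt h3]
      simp
    · have : j - k ≠ 0 := by omega
      simp [this]
  · omega
  -- With `s = k + r + 1`, at least one antiderivative is left after `k` derivatives, and the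
  -- outermost one vanishes at `-1`.
  · obtain ⟨r, rfl⟩ := Nat.exists_eq_add_of_lt hk
    rw [add_assoc, iterate_derivative_iterate_antideriv, Function.iterate_succ_apply',
      eval_antideriv_neg_one, mul_zero]

theorem intervalForm_sobolevProfile_of_ne {α : ℝ} (hα : -1 < α) (s : ℕ) (lam : ℕ → ℝ) {i j : ℕ}
    (hij : i ≠ j) :
    intervalForm α s lam (sobolevProfile α s i) (sobolevProfile α s j) = 0 := by
  rw [intervalForm, Finset.sum_eq_zero, add_zero, iterate_derivative_sobolevProfile hα,
    iterate_derivative_sobolevProfile hα]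
  · split_ifs with h1 h2 h2
    · simp
    · simp
    · simp
    · rw [mul_mul_mul_comm, ← map_mul, ← Polynomial.smul_eq_C_mul, map_smul,
        powerMoment_shiftedJacobi_mul_of_ne hα (by omega), smul_zero]
  · intro k hk
    rw [eval_iterate_derivative_sobolevProfile α (Finset.mem_range.1 hk),
      eval_iterate_derivative_sobolevProfile α (Finset.mem_range.1 hk)]
    split_ifs with h1 h2
    · omega
    · simp
    · simp
    · simp

/-- Only one half of the form contributes: a single boundary term when `j < s`, and the integral
otherwise. -/
theorem intervalForm_sobolevProfile_self {α : ℝ} (hα : -1 < α) (s : ℕ) (lam : ℕ → ℝ) (j : ℕ) :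
    intervalForm α s lam (sobolevProfile α s j) (sobolevProfile α s j)
      = if j < s then 2 ^ (2 * j) * lam j else
        2 ^ (2 * s) * jacobiA α 0 (j - s) ^ 2 * (α + 2 * (j - s : ℕ) + 1)⁻¹ := by
  have h2 : ∀ k : ℕ, ((-2 : ℝ) ^ k) * (-2) ^ k = 2 ^ (2 * k) := fun k => by
    rw [← mul_pow, pow_mul]; norm_num
  rw [intervalForm, iterate_derivative_sobolevProfile hα]
  split_ifs with h
  · rw [zero_mul, map_zero, zero_add, Finset.sum_eq_single j]
    · rw [eval_iterate_derivative_sobolevProfile α h, if_pos rfl, h2, mul_comm]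
    · intro k hk hkj
      rw [eval_iterate_derivative_sobolevProfile α (Finset.mem_range.1 hk), if_neg hkj.symm]
      simp
    · intro hj
      exact absurd (Finset.mem_range.2 h) hj
  · rw [Finset.sum_eq_zero, add_zero, mul_mul_mul_comm, ← map_mul, ← Polynomial.smul_eq_C_mul,
      map_smul, powerMoment_shiftedJacobi_sq hα, smul_eq_mul, mul_mul_mul_comm, h2, pow_two]
    intro k hk
    have hk' := Finset.mem_range.1 hk
    rw [eval_iterate_derivative_sobolevProfile α hk', if_neg (by omega)]
    simp

theorem intervalForm_sobolevProfile_self_pos {α : ℝ} (hα : -1 < α) (s : ℕ) {lam : ℕ → ℝ}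
    (hlam : ∀ k < s, 0 < lam k) (j : ℕ) :
    0 < intervalForm α s lam (sobolevProfile α s j) (sobolevProfile α s j) := by
  rw [intervalForm_sobolevProfile_self hα]
  split_ifs with h
  · have := hlam j h
    positivity
  · have h1 := jacobiA_pos hα (j - s)
    have h2 : 0 < α + 2 * (j - s : ℕ) + 1 := by
      have : (0 : ℝ) ≤ (j - s : ℕ) := Nat.cast_nonneg _
      linarith
    positivity

/-- A smaller degree would kill a quantity known to be nonzero: the `j`-th derivative at `1` if `j <
s`, or the coefficient of order `j - s` in the `s`-th derivative if `j ≥ s`. -/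
theorem natDegree_sobolevProfile {α : ℝ} (hα : -1 < α) (s j : ℕ) :
    (sobolevProfile α s j).natDegree = j := by
  refine le_antisymm (natDegree_sobolevProfile_le α s j) (not_lt.1 fun hlt => ?_)
  rcases lt_or_ge j s with h | h
  · have h1 := eval_iterate_derivative_sobolevProfile α h j
    rw [Polynomial.iterate_derivative_eq_zero hlt, Polynomial.eval_zero, if_pos rfl] at h1
    exact pow_ne_zero j (by norm_num) h1.symm
  · have h1 := congrArg (fun p => p.coeff (j - s)) (iterate_derivative_sobolevProfile hα s j)
    simp only [Polynomial.coeff_iterate_derivative, Nat.sub_add_cancel h,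
      Polynomial.coeff_eq_zero_of_natDegree_lt hlt, smul_zero, if_neg (not_lt.2 h),
      Polynomial.coeff_C_mul] at h1
    have h2 : (-2 : ℝ) ^ s ≠ 0 := by positivity
    exact mul_ne_zero (mul_ne_zero h2 (jacobiA_pos hα _).ne')
      (coeff_shiftedJacobi_ne_zero hα _) h1.symm

theorem span_sobolevProfile {α : ℝ} (hα : -1 < α) (s b : ℕ) :
    Submodule.span ℝ (sobolevProfile α s '' Set.Iic b) = Polynomial.degreeLE ℝ b := by
  -- Nonvanishing is read off from positivity of the form, with all boundary parameters chosen equal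
  -- to `1`.
  have hne : ∀ j, sobolevProfile α s j ≠ 0 := fun j h => by
    have h1 := intervalForm_sobolevProfile_self_pos hα s (lam := fun _ => 1)
      (fun _ _ => one_pos) j
    simp [h, intervalForm] at h1
  let S : Polynomial.Sequence ℝ :=
    ⟨sobolevProfile α s, fun j => by
      rw [Polynomial.degree_eq_natDegree (hne j), natDegree_sobolevProfile hα]⟩
  exact S.span_degreeLE fun j _ => (Polynomial.leadingCoeff_ne_zero.2 (hne j)).isUnit

/-! ### The Sobolev form on the cone -/

/-- The polynomial `p(t) Y(x)` on the cone. -/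
def coneTerm (d : ℕ) : Polynomial ℝ →ₗ[ℝ] MvPolynomial (Fin d) ℝ →ₗ[ℝ] ConeRing d :=
  LinearMap.mk₂ ℝ (fun p Y => toCone d
      (Polynomial.aeval (X (Fin.last d) : Ambient d) p * rename Fin.castSucc Y))
    (fun p q Y => by rw [map_add, add_mul, map_add])
    (fun a p Y => by rw [map_smul, smul_mul_assoc, map_smul])
    (fun p Y Z => by rw [map_add (rename _), mul_add, map_add])
    (fun a p Y => by rw [map_smul (rename _), mul_smul_comm, map_smul])

theorem coneTerm_apply (d : ℕ) (p : Polynomial ℝ) (Y : MvPolynomial (Fin d) ℝ) :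
    coneTerm d p Y = toCone d
      (Polynomial.aeval (X (Fin.last d) : Ambient d) p * rename Fin.castSucc Y) := rfl

theorem sobolevS_eq_coneTerm (d s : ℕ) (β : ℝ) (n m : ℕ) (Y : MvPolynomial (Fin d) ℝ) :
    sobolevS d s β n m Y = coneTerm d (sobolevProfile (s + 2 * m + β + d - 1) s (n - m)) Y := by
  have h : Polynomial.aeval (X (Fin.last d) : Ambient d) (1 - 2 * Polynomial.X : Polynomial ℝ)
      = 1 - 2 * X (Fin.last d) := by
    rw [map_sub, map_one, map_mul, map_ofNat, Polynomial.aeval_X]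
  rw [sobolevS, coneTerm_apply, sobolevProfile, Polynomial.aeval_comp, h]

theorem dt_pow_coneTerm {d m : ℕ} [NeZero d] (k : ℕ) (p : Polynomial ℝ)
    {Y : MvPolynomial (Fin d) ℝ} (hY : Y ∈ solidHarmonics d m) :
    (dt d ^ k) (coneTerm d p Y) = coneTerm d (Polynomial.derivative^[k] p) Y := by
  induction k generalizing p with
  | zero => simp
  | succ k ih =>
    rw [pow_succ, Module.End.mul_apply, coneTerm_apply, dt_mul_solidHarmonic d p Y hY,
      ← coneTerm_apply, ih, Function.iterate_succ_apply]

theorem coneEval_toCone (d : ℕ) (t : ℝ) (ξ : Metric.sphere (0 : EuclideanSpace ℝ (Fin d)) 1)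
    (F : Ambient d) :
    coneEval d t ξ (toCone d F)
      = eval (Fin.snoc (fun i : Fin d => t * ξ.1 i) t : Fin (d + 1) → ℝ) F := by
  rw [← coe_aeval_eq_eval]
  rfl

theorem coneEval_coneTerm {d m : ℕ} (t : ℝ)
    (ξ : Metric.sphere (0 : EuclideanSpace ℝ (Fin d)) 1) (p : Polynomial ℝ)
    {Y : MvPolynomial (Fin d) ℝ} (hY : Y.IsHomogeneous m) :
    coneEval d t ξ (coneTerm d p Y) = p.eval t * (t ^ m * eval (fun i => ξ.1 i) Y) := by
  have h1 : eval (Fin.snoc (fun i : Fin d => t * ξ.1 i) t : Fin (d + 1) → ℝ)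
      (Polynomial.aeval (X (Fin.last d) : Ambient d) p) = p.eval t := by
    rw [← coe_aeval_eq_eval, RingHom.coe_coe, ← Polynomial.aeval_algHom_apply, aeval_X,
      Fin.snoc_last, Polynomial.coe_aeval_eq_eval]
  rw [coneTerm_apply, coneEval_toCone, map_mul, h1, eval_rename, ← eval_smul_of_isHomogeneous hY]
  congr 3
  ext i
  simp

theorem continuous_coneEval (d : ℕ) (f : ConeRing d) :
    Continuous fun z : ℝ × Metric.sphere (0 : EuclideanSpace ℝ (Fin d)) 1 =>
      coneEval d z.1 z.2 f := by
  obtain ⟨F, rfl⟩ := Ideal.Quotient.mk_surjective f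
  have h : ∀ z : ℝ × Metric.sphere (0 : EuclideanSpace ℝ (Fin d)) 1,
      coneEval d z.1 z.2 (Ideal.Quotient.mk (coneIdeal d) F) = _ := fun z =>
    coneEval_toCone d z.1 z.2 F
  simp only [h]
  refine F.continuous_eval.comp (continuous_pi fun j => ?_)
  induction j using Fin.lastCases with
  | last => simpa using continuous_fst
  | cast i =>
    simp only [Fin.snoc_castSucc]
    exact continuous_fst.mul
      ((EuclideanSpace.proj (𝕜 := ℝ) i).continuous.comp (continuous_subtype_val.comp continuous_snd))

/-- The integral of `f g` over the section of the cone at height `t`. -/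
def sectionIntegral (d : ℕ) (f g : ConeRing d) (t : ℝ) : ℝ :=
  sphereIntegral d fun ξ => coneEval d t ξ f * coneEval d t ξ g

theorem continuous_sectionIntegral (d : ℕ) (f g : ConeRing d) :
    Continuous (sectionIntegral d f g) := by
  have h := continuous_parametric_integral_of_continuous
    (μ := (volume : Measure (EuclideanSpace ℝ (Fin d))).toSphere)
    (f := fun (t : ℝ) ξ => coneEval d t ξ f * coneEval d t ξ g)
    ((continuous_coneEval d f).mul (continuous_coneEval d g)) isCompact_univ
  simp only [setIntegral_univ] at h
  exact h

theorem integrable_coneEval_mul (d : ℕ) (f g : ConeRing d) (t : ℝ) :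
    Integrable (fun ξ => coneEval d t ξ f * coneEval d t ξ g)
      (volume : Measure (EuclideanSpace ℝ (Fin d))).toSphere := by
  have hc : ∀ f : ConeRing d, Continuous fun ξ : Metric.sphere (0 : EuclideanSpace ℝ (Fin d)) 1 =>
      coneEval d t ξ f := by
    intro f
    have h1 := continuous_coneEval d f
    have h2 : Continuous fun ξ : Metric.sphere (0 : EuclideanSpace ℝ (Fin d)) 1 => (t, ξ) :=
      Continuous.prodMk_right t
    have h3 := h1.comp h2
    simp only [Function.comp_def] at h3
    exact h3
  exact ((hc f).mul (hc g)).integrable_of_hasCompactSupport (HasCompactSupport.of_compactSpace _)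

theorem sectionIntegral_comm (d : ℕ) (f g : ConeRing d) (t : ℝ) :
    sectionIntegral d f g t = sectionIntegral d g f t := by
  simp only [sectionIntegral, mul_comm]

theorem sectionIntegral_add_left (d : ℕ) (f f' g : ConeRing d) (t : ℝ) :
    sectionIntegral d (f + f') g t = sectionIntegral d f g t + sectionIntegral d f' g t := by
  simp only [sectionIntegral, sphereIntegral, map_add, add_mul]
  exact integral_add (integrable_coneEval_mul d f g t) (integrable_coneEval_mul d f' g t)

theorem sectionIntegral_smul_left (d : ℕ) (a : ℝ) (f g : ConeRing d) (t : ℝ) :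
    sectionIntegral d (a • f) g t = a * sectionIntegral d f g t := by
  simp only [sectionIntegral, sphereIntegral, map_smul, smul_eq_mul, mul_assoc]
  exact integral_const_mul _ _

/-- The factor `t ^ (d - 1)` of the measure has to be merged with the weight, since for `b = β + s`
the power `t ^ b` need not be integrable at `0` by itself. The exponents are added on `(0, 1]` only,
avoiding `t = 0`. -/
theorem coneIntegral_eq (d : ℕ) [NeZero d] (b : ℝ) (f g : ConeRing d) :
    coneIntegral d (fun t ξ => coneEval d t ξ f * coneEval d t ξ g * t ^ b)
      = ∫ t in (0 : ℝ)..1, t ^ (b + d - 1) * sectionIntegral d f g t := by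
  refine intervalIntegral.integral_congr_ae (Filter.Eventually.of_forall fun t ht => ?_)
  rw [Set.uIoc_of_le zero_le_one] at ht
  have hd : 1 ≤ d := NeZero.one_le
  have h : t ^ (b + d - 1) = t ^ (d - 1) * t ^ b := by
    rw [← Real.rpow_natCast t (d - 1), ← Real.rpow_add ht.1]
    push_cast [hd]
    congr 1
    ring
  have h2 : sphereIntegral d (fun ξ => coneEval d t ξ f * coneEval d t ξ g * t ^ b)
      = sectionIntegral d f g t * t ^ b := integral_mul_const _ _
  rw [h2, h]
  ring

theorem sobolevInner_eq (d : ℕ) [NeZero d] (s : ℕ) (β : ℝ) (lam : ℕ → ℝ) (f g : ConeRing d) :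
    sobolevInner d s β lam f g
      = (1 / sphereArea d) * (∫ t in (0 : ℝ)..1, t ^ (β + s + d - 1) *
          sectionIntegral d ((dt d ^ s) f) ((dt d ^ s) g) t)
        + ∑ k ∈ Finset.range s, (lam k / sphereArea d) *
          sectionIntegral d ((dt d ^ k) f) ((dt d ^ k) g) 1 := by
  rw [sobolevInner, coneIntegral_eq]
  rfl

theorem sobolevInner_comm (d : ℕ) [NeZero d] (s : ℕ) (β : ℝ) (lam : ℕ → ℝ) (f g : ConeRing d) :
    sobolevInner d s β lam f g = sobolevInner d s β lam g f := by
  simp only [sobolevInner_eq, sectionIntegral_comm d ((dt d ^ _) f)]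

/-- The Sobolev inner product as a bilinear form. -/
def sobolevForm (d : ℕ) [NeZero d] (s : ℕ) (β : ℝ) (hβ : -(d : ℝ) - s < β) (lam : ℕ → ℝ) :
    LinearMap.BilinForm ℝ (ConeRing d) :=
  -- This reformulation of `hβ` is the integrability of the merged weight at `0`, on which
  -- additivity of the integral relies.
  have hα : -1 < β + s + d - 1 := by linarith
  have hadd : ∀ f f' g, sobolevInner d s β lam (f + f') g
      = sobolevInner d s β lam f g + sobolevInner d s β lam f' g := fun f f' g => by
    have hi : ∀ f g : ConeRing d, IntervalIntegrable
        (fun t : ℝ => t ^ (β + s + d - 1) * sectionIntegral d f g t) volume 0 1 := fun f g =>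
      (intervalIntegral.intervalIntegrable_rpow' hα).mul_continuousOn
        (continuous_sectionIntegral d f g).continuousOn
    simp only [sobolevInner_eq, map_add, sectionIntegral_add_left, mul_add,
      Finset.sum_add_distrib]
    rw [intervalIntegral.integral_add (hi _ _) (hi _ _)]
    ring
  have hsmul : ∀ (a : ℝ) f g, sobolevInner d s β lam (a • f) g
      = a • sobolevInner d s β lam f g := fun a f g => by
    simp only [sobolevInner_eq, map_smul, sectionIntegral_smul_left, mul_left_comm _ a,
      ← Finset.mul_sum, intervalIntegral.integral_const_mul, smul_eq_mul, mul_add]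
  LinearMap.mk₂ ℝ (sobolevInner d s β lam) hadd hsmul
    (fun f g g' => by simp only [sobolevInner_comm d s β lam f, hadd])
    (fun a f g => by simp only [sobolevInner_comm d s β lam f, hsmul])

theorem sectionIntegral_coneTerm {d m m' : ℕ} (p q : Polynomial ℝ)
    {Y Z : MvPolynomial (Fin d) ℝ} (hY : Y.IsHomogeneous m) (hZ : Z.IsHomogeneous m') (t : ℝ) :
    sectionIntegral d (coneTerm d p Y) (coneTerm d q Z) t
      = t ^ (m + m') * (p * q).eval t *
        sphereIntegral d fun ξ => eval (fun i => ξ.1 i) Y * eval (fun i => ξ.1 i) Z := by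
  rw [sphereIntegral, ← integral_const_mul]
  refine integral_congr_ae (Filter.Eventually.of_forall fun ξ => ?_)
  simp only [coneEval_coneTerm t ξ p hY, coneEval_coneTerm t ξ q hZ, Polynomial.eval_mul]
  ring

/-- Separation of variables: `∂_t` leaves the harmonics untouched, and their homogeneity contributes
`t ^ (m + m')`, which is absorbed into the weight and equals `1` in the boundary terms. -/
theorem sobolevInner_coneTerm {d m m' : ℕ} [NeZero d] {s : ℕ} {β : ℝ}
    (hβ : -(d : ℝ) - s < β) (lam : ℕ → ℝ) (p q : Polynomial ℝ)
    {Y Z : MvPolynomial (Fin d) ℝ} (hY : Y ∈ solidHarmonics d m) (hZ : Z ∈ solidHarmonics d m') :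
    sobolevInner d s β lam (coneTerm d p Y) (coneTerm d q Z)
      = sphereInner d Y Z * intervalForm (s + (m + m' : ℕ) + β + d - 1) s lam p q := by
  have hY' := (mem_homogeneousSubmodule _ _).1 hY.1
  have hZ' := (mem_homogeneousSubmodule _ _).1 hZ.1
  have hα : -1 < s + (m + m' : ℕ) + β + d - 1 := by
    have : (0 : ℝ) ≤ (m + m' : ℕ) := Nat.cast_nonneg _
    linarith
  have hI : ∀ (P : Polynomial ℝ) (c : ℝ),
      ∫ t in (0 : ℝ)..1, t ^ (β + s + d - 1) * (t ^ (m + m') * P.eval t * c)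
        = powerMoment (s + (m + m' : ℕ) + β + d - 1) P * c := by
    intro P c
    rw [← integral_rpow_mul_eval hα, ← intervalIntegral.integral_mul_const]
    refine intervalIntegral.integral_congr_ae (Filter.Eventually.of_forall fun t ht => ?_)
    rw [Set.uIoc_of_le zero_le_one] at ht
    have h : t ^ (s + (m + m' : ℕ) + β + d - 1) = t ^ (β + s + d - 1) * t ^ (m + m') := by
      rw [← Real.rpow_natCast t (m + m'), ← Real.rpow_add ht.1]
      congr 1
      ring
    rw [h]
    ring
  simp only [sobolevInner_eq, dt_pow_coneTerm _ _ hY, dt_pow_coneTerm _ _ hZ,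
    sectionIntegral_coneTerm _ _ hY' hZ', hI, one_pow, one_mul]
  rw [sphereInner, intervalForm, mul_add, Finset.mul_sum]
  congr 1
  · ring
  · refine Finset.sum_congr rfl fun k _ => ?_
    rw [Polynomial.eval_mul]
    ring

theorem coneTerm_mem_conePolys {d m n : ℕ} {p : Polynomial ℝ} {Y : MvPolynomial (Fin d) ℝ}
    (hY : Y.IsHomogeneous m) (h : p.natDegree + m ≤ n) : coneTerm d p Y ∈ conePolys d n := by
  refine ⟨_, (mem_restrictTotalDegree _ _ _).2 ?_, rfl⟩
  refine (totalDegree_mul _ _).trans ((Nat.add_le_add ?_ ?_).trans h)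
  · rw [Polynomial.aeval_eq_sum_range]
    refine totalDegree_finsetSum_le fun i hi => (totalDegree_smul_le _ _).trans ?_
    rw [totalDegree_X_pow]
    exact Nat.lt_succ_iff.1 (Finset.mem_range.1 hi)
  · exact (totalDegree_rename_le _ _).trans hY.totalDegree_le

/-! ### The orthogonal basis -/

/-- Pairing `f` with `v i` isolates the `i`-th coefficient times the nonzero `B (v i) (v i)`, so the
coefficients outside `t` are zero. -/
theorem mem_span_image_of_orthogonal {ι M : Type*} [AddCommGroup M] [Module ℝ M]
    (B : LinearMap.BilinForm ℝ M) {v : ι → M} (hv : ∀ i j, i ≠ j → B (v i) (v j) = 0)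
    (hn : ∀ i, B (v i) (v i) ≠ 0) {s t : Set ι} {f : M} (hf : f ∈ Submodule.span ℝ (v '' s))
    (ht : ∀ i ∈ s, i ∉ t → B f (v i) = 0) : f ∈ Submodule.span ℝ (v '' t) := by
  obtain ⟨c, hc, rfl⟩ := (Finsupp.mem_span_image_iff_linearCombination ℝ).1 hf
  refine (Finsupp.mem_span_image_iff_linearCombination ℝ).2 ⟨c, ?_, rfl⟩
  rw [Finsupp.mem_supported]
  intro i hi
  by_contra hit
  have h := ht i ((Finsupp.mem_supported ℝ c).1 hc hi) hit
  rw [Finsupp.linearCombination_apply, Finsupp.sum, map_sum, LinearMap.sum_apply,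
    Finset.sum_eq_single i] at h
  · rw [map_smul, LinearMap.smul_apply, smul_eq_mul] at h
    exact (mul_eq_zero.1 h).elim (Finsupp.mem_support_iff.1 hi) (hn i)
  · intro j _ hj
    rw [map_smul, LinearMap.smul_apply, hv j i hj, smul_zero]
  · intro h'
    exact absurd hi h'

theorem sobolevInner_sobolevS {d m m' : ℕ} [NeZero d] {s : ℕ} {β : ℝ}
    (hβ : -(d : ℝ) - s < β) (lam : ℕ → ℝ) (n n' : ℕ) {Y Z : MvPolynomial (Fin d) ℝ}
    (hY : Y ∈ solidHarmonics d m) (hZ : Z ∈ solidHarmonics d m') :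
    sobolevInner d s β lam (sobolevS d s β n m Y) (sobolevS d s β n' m' Z)
      = sphereInner d Y Z * intervalForm (s + (m + m' : ℕ) + β + d - 1) s lam
        (sobolevProfile (s + 2 * m + β + d - 1) s (n - m))
        (sobolevProfile (s + 2 * m' + β + d - 1) s (n' - m')) := by
  rw [sobolevS_eq_coneTerm, sobolevS_eq_coneTerm, sobolevInner_coneTerm hβ lam _ _ hY hZ]

theorem neg_one_lt_weight_exponent {d s : ℕ} {β : ℝ} (hβ : -(d : ℝ) - s < β) (m : ℕ) :
    -1 < s + 2 * (m : ℝ) + β + d - 1 := by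
  have : (0 : ℝ) ≤ m := Nat.cast_nonneg _
  linarith

/-- For equal harmonic degrees the weight exponent involves `m + m = 2m` and coincides with the
parameter of both profiles, so the one-variable orthogonality applies. -/
theorem sobolevInner_sobolevS_same_degree {d m : ℕ} [NeZero d] {s : ℕ} {β : ℝ}
    (hβ : -(d : ℝ) - s < β) (lam : ℕ → ℝ) (n n' : ℕ) {Y Z : MvPolynomial (Fin d) ℝ}
    (hY : Y ∈ solidHarmonics d m) (hZ : Z ∈ solidHarmonics d m) :
    sobolevInner d s β lam (sobolevS d s β n m Y) (sobolevS d s β n' m Z)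
      = sphereInner d Y Z * intervalForm (s + 2 * m + β + d - 1) s lam
        (sobolevProfile (s + 2 * m + β + d - 1) s (n - m))
        (sobolevProfile (s + 2 * m + β + d - 1) s (n' - m)) := by
  rw [sobolevInner_sobolevS hβ lam n n' hY hZ, ← two_mul, Nat.cast_mul, Nat.cast_ofNat]

theorem sobolevInner_sobolevS_eq_zero {d : ℕ} [NeZero d] {s : ℕ} {β : ℝ}
    (hβ : -(d : ℝ) - s < β) {lam : ℕ → ℝ}
    {Y : ∀ m : ℕ, Module.Basis (Fin (Module.finrank ℝ (solidHarmonics d m))) ℝ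
      (solidHarmonics d m)}
    (hY : ∀ m ℓ ℓ', sphereInner d (Y m ℓ) (Y m ℓ') = if ℓ = ℓ' then 1 else 0)
    {n n' m m' : ℕ} (hm : m ≤ n) (hm' : m' ≤ n')
    (ℓ : Fin (Module.finrank ℝ (solidHarmonics d m)))
    (ℓ' : Fin (Module.finrank ℝ (solidHarmonics d m')))
    (h : n ≠ n' ∨ m ≠ m' ∨ (ℓ : ℕ) ≠ (ℓ' : ℕ)) :
    sobolevInner d s β lam (sobolevS d s β n m (Y m ℓ)) (sobolevS d s β n' m' (Y m' ℓ')) = 0 := by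
  by_cases hmm : m = m'
  · subst hmm
    rw [sobolevInner_sobolevS_same_degree hβ lam n n' (Y m ℓ).2 (Y m ℓ').2, hY]
    split_ifs with hl
    · subst hl
      have hn : n ≠ n' := by simpa using h
      -- The bounds `hm` and `hm'` enter here: truncated subtraction of `m` separates `n` from `n'`
      -- only above `m`.
      rw [intervalForm_sobolevProfile_of_ne (neg_one_lt_weight_exponent hβ m) s lam (by omega),
        mul_zero]
    · rw [zero_mul]
  · rw [sobolevInner_sobolevS hβ lam n n' (Y m ℓ).2 (Y m' ℓ').2,
      sphereInner_eq_zero hmm (Y m ℓ).2 (Y m' ℓ').2, zero_mul]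

theorem sobolevInner_sobolevS_self {d : ℕ} [NeZero d] {s : ℕ} {β : ℝ}
    (hβ : -(d : ℝ) - s < β) {lam : ℕ → ℝ}
    {Y : ∀ m : ℕ, Module.Basis (Fin (Module.finrank ℝ (solidHarmonics d m))) ℝ
      (solidHarmonics d m)}
    (hY : ∀ m ℓ ℓ', sphereInner d (Y m ℓ) (Y m ℓ') = if ℓ = ℓ' then 1 else 0)
    (n m : ℕ) (ℓ : Fin (Module.finrank ℝ (solidHarmonics d m))) :
    sobolevInner d s β lam (sobolevS d s β n m (Y m ℓ)) (sobolevS d s β n m (Y m ℓ))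
      = intervalForm (s + 2 * m + β + d - 1) s lam
        (sobolevProfile (s + 2 * m + β + d - 1) s (n - m))
        (sobolevProfile (s + 2 * m + β + d - 1) s (n - m)) := by
  rw [sobolevInner_sobolevS_same_degree hβ lam n n (Y m ℓ).2 (Y m ℓ).2, hY, if_pos rfl, one_mul]

/-- The powers of two from the interval `[-1, 1]` combine with the prefactor to `2 ^ (2s)`, the
square of the chain-rule factor `(-2) ^ s`. -/
theorem two_rpow_mul_jacobiHatH {d s m : ℕ} {β : ℝ} (hβ : -(d : ℝ) - s < β) (j : ℕ) :
    (2 : ℝ) ^ ((s : ℝ) - β - 2 * m - d) * jacobiHatH (s + 2 * m + β + d - 1) 0 j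
      = 2 ^ (2 * s) * jacobiA (s + 2 * m + β + d - 1) 0 j ^ 2 *
        (s + 2 * m + β + d - 1 + 2 * j + 1)⁻¹ := by
  have h : (2 : ℝ) ^ ((s : ℝ) - β - 2 * m - d) * 2 ^ ((s : ℝ) + 2 * m + β + d - 1 + 1)
      = 2 ^ (2 * s) := by
    rw [← Real.rpow_add two_pos, ← Real.rpow_natCast]
    congr 1
    push_cast
    ring
  rw [jacobiHatH_zero_right (neg_one_lt_weight_exponent hβ m), ← h]
  ring

/-- The polynomials `S^n_{m,ℓ}` of all degrees, as one family. -/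
def sobolevFamily (d s : ℕ) (β : ℝ)
    (Y : ∀ m : ℕ, Module.Basis (Fin (Module.finrank ℝ (solidHarmonics d m))) ℝ
      (solidHarmonics d m))
    (i : (n : ℕ) × (m : Fin (n + 1)) × Fin (Module.finrank ℝ (solidHarmonics d m))) :
    ConeRing d :=
  sobolevS d s β i.1 i.2.1 (Y i.2.1 i.2.2)

theorem sobolevFamily_orthogonal {d : ℕ} [NeZero d] {s : ℕ} {β : ℝ}
    (hβ : -(d : ℝ) - s < β) {lam : ℕ → ℝ}
    {Y : ∀ m : ℕ, Module.Basis (Fin (Module.finrank ℝ (solidHarmonics d m))) ℝ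
      (solidHarmonics d m)}
    (hY : ∀ m ℓ ℓ', sphereInner d (Y m ℓ) (Y m ℓ') = if ℓ = ℓ' then 1 else 0)
    {i j : (n : ℕ) × (m : Fin (n + 1)) × Fin (Module.finrank ℝ (solidHarmonics d m))}
    (hij : i ≠ j) :
    sobolevInner d s β lam (sobolevFamily d s β Y i) (sobolevFamily d s β Y j) = 0 := by
  obtain ⟨n, m, ℓ⟩ := i
  obtain ⟨n', m', ℓ'⟩ := j
  refine sobolevInner_sobolevS_eq_zero hβ hY (Nat.lt_succ_iff.1 m.2) (Nat.lt_succ_iff.1 m'.2)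
    ℓ ℓ' ?_
  by_contra! h
  obtain ⟨rfl, h2, h3⟩ := h
  obtain rfl := Fin.ext h2
  exact hij (by rw [Fin.ext h3])

theorem sobolevFamily_self_ne_zero {d : ℕ} [NeZero d] {s : ℕ} {β : ℝ}
    (hβ : -(d : ℝ) - s < β) {lam : ℕ → ℝ} (hlam : ∀ k < s, 0 < lam k)
    {Y : ∀ m : ℕ, Module.Basis (Fin (Module.finrank ℝ (solidHarmonics d m))) ℝ
      (solidHarmonics d m)}
    (hY : ∀ m ℓ ℓ', sphereInner d (Y m ℓ) (Y m ℓ') = if ℓ = ℓ' then 1 else 0)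
    (i : (n : ℕ) × (m : Fin (n + 1)) × Fin (Module.finrank ℝ (solidHarmonics d m))) :
    sobolevInner d s β lam (sobolevFamily d s β Y i) (sobolevFamily d s β Y i) ≠ 0 := by
  rw [sobolevFamily, sobolevInner_sobolevS_self hβ hY]
  exact (intervalForm_sobolevProfile_self_pos (neg_one_lt_weight_exponent hβ _) s hlam _).ne'

theorem sobolevFamily_mem_conePolys {d : ℕ} (s : ℕ) (β : ℝ)
    (Y : ∀ m : ℕ, Module.Basis (Fin (Module.finrank ℝ (solidHarmonics d m))) ℝ
      (solidHarmonics d m))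
    (i : (n : ℕ) × (m : Fin (n + 1)) × Fin (Module.finrank ℝ (solidHarmonics d m))) :
    sobolevFamily d s β Y i ∈ conePolys d i.1 := by
  obtain ⟨n, m, ℓ⟩ := i
  rw [sobolevFamily, sobolevS_eq_coneTerm]
  refine coneTerm_mem_conePolys ((mem_homogeneousSubmodule _ _).1 (Y m ℓ).2.1) ?_
  have h := natDegree_sobolevProfile_le (s + 2 * ((m : ℕ) : ℝ) + β + d - 1) s (n - m)
  have hm := m.2
  dsimp only at h ⊢
  omega

/-- By bilinearity of `coneTerm`, `t ^ b Z` expands through the profiles of degree at most `b` and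
the basis of harmonics of degree `m`. -/
theorem conePolys_le_span_sobolevFamily {d : ℕ} [NeZero d] {s : ℕ} {β : ℝ}
    (hβ : -(d : ℝ) - s < β)
    (Y : ∀ m : ℕ, Module.Basis (Fin (Module.finrank ℝ (solidHarmonics d m))) ℝ
      (solidHarmonics d m)) (n : ℕ) :
    conePolys d n ≤ Submodule.span ℝ (sobolevFamily d s β Y '' {i | i.1 ≤ n}) := by
  refine conePolys_le fun b m Z hZ hbm => ?_
  have hspan : Submodule.span ℝ (Set.range fun ℓ => (Y m ℓ : MvPolynomial (Fin d) ℝ))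
      = solidHarmonics d m := by
    have h : (Set.range fun ℓ => (Y m ℓ : MvPolynomial (Fin d) ℝ))
        = (solidHarmonics d m).subtype '' Set.range (Y m) := by
      rw [← Set.range_comp]
      rfl
    rw [h, Submodule.span_image, (Y m).span_eq, Submodule.map_top, Submodule.range_subtype]
  have hX : (Polynomial.X ^ b : Polynomial ℝ) ∈ Polynomial.degreeLE ℝ b := by
    rw [Polynomial.mem_degreeLE]
    exact Polynomial.degree_X_pow_le b
  have h := Submodule.apply_mem_map₂ (coneTerm d) hX hZ
  rw [coneTerm_apply, map_pow, Polynomial.aeval_X, ← hspan,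
    ← span_sobolevProfile (neg_one_lt_weight_exponent hβ m) s b, Submodule.map₂_span_span] at h
  refine Submodule.span_mono ?_ h
  rintro _ ⟨_, ⟨j, hj, rfl⟩, _, ⟨ℓ, rfl⟩, rfl⟩
  -- The profile of degree `j` with a harmonic of degree `m` occurs at total degree `j + m`.
  refine ⟨⟨j + m, ⟨m, by omega⟩, ℓ⟩, ?_, ?_⟩
  · have hj' : j ≤ b := hj
    change j + m ≤ n
    omega
  · rw [sobolevFamily, sobolevS_eq_coneTerm]
    simp only [Nat.add_sub_cancel]

/-- One inclusion holds because lower-degree polynomials are combinations of members of lower index.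
For the other, `f` expands in members of index at most `n`, and orthogonality to those of index
below `n` removes their coefficients. -/
theorem span_sobolevS_eq_orthogonalPolys {d : ℕ} [NeZero d] {s : ℕ} {β : ℝ}
    (hβ : -(d : ℝ) - s < β) {lam : ℕ → ℝ} (hlam : ∀ k < s, 0 < lam k)
    {Y : ∀ m : ℕ, Module.Basis (Fin (Module.finrank ℝ (solidHarmonics d m))) ℝ
      (solidHarmonics d m)}
    (hY : ∀ m ℓ ℓ', sphereInner d (Y m ℓ) (Y m ℓ') = if ℓ = ℓ' then 1 else 0)
    (n : ℕ) :
    (Submodule.span ℝ (sobolevFamily d s β Y '' {i | i.1 = n}) : Set (ConeRing d))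
      = orthogonalPolys d s β lam n := by
  have hsub : sobolevFamily d s β Y '' {i | i.1 = n} ⊆ orthogonalPolys d s β lam n := by
    rintro _ ⟨i, rfl, rfl⟩
    refine ⟨sobolevFamily_mem_conePolys s β Y i, fun k hk g hg => ?_⟩
    have hg' := conePolys_le_span_sobolevFamily hβ Y k hg
    have hle : Submodule.span ℝ (sobolevFamily d s β Y '' {j | j.1 ≤ k})
        ≤ LinearMap.ker (sobolevForm d s β hβ lam (sobolevFamily d s β Y i)) := by
      rw [Submodule.span_le]
      rintro _ ⟨j, hj, rfl⟩
      refine sobolevFamily_orthogonal hβ hY fun h => ?_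
      subst h
      exact absurd hj (not_le.2 hk)
    exact hle hg'
  refine Set.Subset.antisymm (fun f hf => ?_) fun f hf => ?_
  · refine ⟨?_, fun k hk g hg => ?_⟩
    · refine (Submodule.span_le.2 fun g hg => ?_ : _ ≤ conePolys d n) hf
      exact (hsub hg).1
    · have hle : Submodule.span ℝ (sobolevFamily d s β Y '' {i | i.1 = n})
          ≤ LinearMap.ker ((sobolevForm d s β hβ lam).flip g) := by
        rw [Submodule.span_le]
        exact fun f hf => (hsub hf).2 k hk g hg
      exact hle hf
  · refine mem_span_image_of_orthogonal (sobolevForm d s β hβ lam)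
      (fun i j hij => sobolevFamily_orthogonal hβ hY hij)
      (fun i => sobolevFamily_self_ne_zero hβ hlam hY i)
      (conePolys_le_span_sobolevFamily hβ Y n hf.1) fun i hi hin => ?_
    exact hf.2 i.1 (lt_of_le_of_ne hi hin) _ (sobolevFamily_mem_conePolys s β Y i)

end SobolevCone

end

/-! ### Basis, orthogonality and norms on the cone -/

theorem mainTheorem1 (d : ℕ) [NeZero d] (s : ℕ) (hs : 0 < s) (β : ℝ)
    (hβ : -(d : ℝ) - (s : ℝ) < β) (lam : ℕ → ℝ) (hlam : ∀ k < s, 0 < lam k)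
    (Y : ∀ m : ℕ, Module.Basis (Fin (Module.finrank ℝ (SobolevCone.solidHarmonics d m))) ℝ
      (SobolevCone.solidHarmonics d m))
    (hY : ∀ m ℓ ℓ', SobolevCone.sphereInner d (Y m ℓ) (Y m ℓ') = if ℓ = ℓ' then 1 else 0) :
    -- the polynomials of index `n` form a basis of the space of orthogonal polynomials
    (∀ n : ℕ,
      LinearIndependent ℝ
        (fun q : (m : Fin (n + 1)) × Fin (Module.finrank ℝ (SobolevCone.solidHarmonics d m)) =>
          SobolevCone.sobolevS d s β n q.1 (Y q.1 q.2)) ∧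
      (Submodule.span ℝ (Set.range
        (fun q : (m : Fin (n + 1)) × Fin (Module.finrank ℝ (SobolevCone.solidHarmonics d m)) =>
          SobolevCone.sobolevS d s β n q.1 (Y q.1 q.2))) : Set (SobolevCone.ConeRing d)) =
        SobolevCone.orthogonalPolys d s β lam n) ∧
    -- they are mutually orthogonal
    (∀ n n' m m' : ℕ, m ≤ n → m' ≤ n' →
      ∀ (ℓ : Fin (Module.finrank ℝ (SobolevCone.solidHarmonics d m)))
        (ℓ' : Fin (Module.finrank ℝ (SobolevCone.solidHarmonics d m'))),
      (n ≠ n' ∨ m ≠ m' ∨ (ℓ : ℕ) ≠ (ℓ' : ℕ)) →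
      SobolevCone.sobolevInner d s β lam (SobolevCone.sobolevS d s β n m (Y m ℓ))
        (SobolevCone.sobolevS d s β n' m' (Y m' ℓ')) = 0) ∧
    -- their squared norms
    (∀ n m : ℕ, m ≤ n → ∀ ℓ : Fin (Module.finrank ℝ (SobolevCone.solidHarmonics d m)),
      SobolevCone.sobolevInner d s β lam (SobolevCone.sobolevS d s β n m (Y m ℓ))
        (SobolevCone.sobolevS d s β n m (Y m ℓ)) =
      if n - m < s then 2 ^ (2 * n - 2 * m) * lam (n - m)
      else (2 : ℝ) ^ ((s : ℝ) - β - 2 * m - d) *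
        SobolevCone.jacobiHatH (s + 2 * m + β + d - 1) 0 (n - m - s)) := by
  have hfam : ∀ n : ℕ, (fun q : (m : Fin (n + 1)) ×
      Fin (Module.finrank ℝ (SobolevCone.solidHarmonics d m)) =>
        SobolevCone.sobolevS d s β n q.1 (Y q.1 q.2))
      = fun q => SobolevCone.sobolevFamily d s β Y ⟨n, q⟩ := fun n => rfl
  refine ⟨fun n => ⟨?_, ?_⟩, fun n n' m m' hm hm' ℓ ℓ' h =>
    SobolevCone.sobolevInner_sobolevS_eq_zero hβ hY hm hm' ℓ ℓ' h, fun n m _ ℓ => ?_⟩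
  · rw [hfam]
    refine LinearMap.BilinForm.linearIndependent_of_iIsOrtho
      (B := SobolevCone.sobolevForm d s β hβ lam) (fun q q' hqq => ?_) fun q => ?_
    · exact SobolevCone.sobolevFamily_orthogonal hβ hY fun h => hqq (by simpa using h)
    · exact SobolevCone.sobolevFamily_self_ne_zero hβ hlam hY ⟨n, q⟩
  · rw [← SobolevCone.span_sobolevS_eq_orthogonalPolys hβ hlam hY n, hfam]
    congr 2
    ext f
    constructor
    · rintro ⟨q, rfl⟩
      exact ⟨⟨n, q⟩, rfl, rfl⟩
    · rintro ⟨⟨_, q⟩, rfl, rfl⟩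
      exact ⟨q, rfl⟩
  · rw [SobolevCone.sobolevInner_sobolevS_self hβ hY,
      SobolevCone.intervalForm_sobolevProfile_self (SobolevCone.neg_one_lt_weight_exponent hβ m),
      SobolevCone.two_rpow_mul_jacobiHatH hβ, Nat.mul_sub]
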